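/- Let $a,b,c,d$ be integers with $0\le c\le a,b\le d\le a+b$, and let $$P=H_{a,b,c,d}=\{(x,y)\in\mathbb{R}^2:\ 0\le x\le a,\ 0\le y\le b,\ c\le x+y\le d\}.$$ Let $P_{\rm int}$ be the convex hull of the lattice points in the interior of $P$, and assume that there are at least two such lattice points. Let $\Delta$ be the honeycomb triangulation of $P$, obtained by slicing $P$ with the lines $x=i$ ($0<i<a$), $y=j$ ($0<j<b$) and $x+y=k$ ($c<k<d$), where $i,j,k$ are integers. Then $$\dim(\mathbb{M}_\Delta)=\#(P_{\rm int}\cap\mathbb{Z}^2)+\#(\partial P_{\rm int}\cap\mathbb{Z}^2)+\#\,\mathrm{vertices}(P_{\rm int})-3 .$$ Here $\partial$ denotes the topological boundary in $\mathbb{R}^2$ (so $\partial P_{\rm int}=P_{\rm int}$ if $P_{\rm int}$ is a segment), and $\mathbb{M}_\Delta$ is defined as follows. Put $A=P\cap\mathbb{Z}^2$. The skeleton $G$ of $\Delta$ is obtained from the dual graph of $\Delta$ (nodes are the triangles, edges join triangles that share an edge) by recursively deleting the nodes of degree one and then merging the two edges at each node of degree two, so that each edge of $G$ is a concatenation of edges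 of the dual graph. For a height function $h:A\to\mathbb{R}$ whose induced regular subdivision of $A$ (projection of the lower convex hull of the lifted points $(z,h(z))$) is $\Delta$, consider the tropical curve of points $(x,y)\in\mathbb{R}^2$ at which the minimum of $ix+jy+h(i,j)$ over $(i,j)\in A$ is attained at least twice. Its bounded edges are dual to the interior edges of $\Delta$, that is, to the edges of the dual graph; give each the lattice length $\ell\ge 0$ for which it is a segment from $p$ to $p+\ell u$ with $u$ a primitive integer vector, and give each edge of $G$ the sum of the lattice lengths of the edges of which it is the concatenation. Then $\mathbb{M}_\Delta$ is the closure, in the space of real vectors indexed by the edges of $G$, of the set of all vectors of edge lengths of $G$ that arise from such $h$. Its dimension is the dimension of its affine hull. -/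

import Mathlib

namespace TropHoneycomb

/-! ### Lattice points and the polygons `H_{a,b,c,d}` -/

/-- The inclusion of the lattice `ℤ²` in the plane `ℝ²`. -/
def toPlane (z : ℤ × ℤ) : ℝ × ℝ := ((z.1 : ℝ), (z.2 : ℝ))

/-- The lattice points of a subset `Q` of the plane. -/
def latticePoints (Q : Set (ℝ × ℝ)) : Set (ℤ × ℤ) := {z | toPlane z ∈ Q}

/-- The interior hull `P_int`: the convex hull of the lattice points in the interior of `P`. -/
def interiorHull (P : Set (ℝ × ℝ)) : Set (ℝ × ℝ) :=
  convexHull ℝ (toPlane '' latticePoints (interior P))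

/-- The polygon `H_{a,b,c,d}`. -/
def honeycombPolygon (a b c d : ℤ) : Set (ℝ × ℝ) :=
  {p | 0 ≤ p.1 ∧ p.1 ≤ a ∧ 0 ≤ p.2 ∧ p.2 ≤ b ∧ c ≤ p.1 + p.2 ∧ p.1 + p.2 ≤ d}

/-! ### Regular subdivisions

A subdivision is recorded by its maximal cells, and a cell by the lattice points that it uses. -/

/-- The maximal cells of the regular subdivision of the point configuration `A` that is induced by
the heights `h`: a cell consists of the points `z` of `A` whose lift `(z, h z)` lies on a given
facet of the lower convex hull of the lifted points, that is, on a non-vertical plane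
`(x, y) ↦ r * x + s * y + t` that lies below all lifted points and touches a non-collinear set of
them. Only the values of `h` on `A` matter. -/
def regularSubdivision (A : Set (ℤ × ℤ)) (h : ℤ × ℤ → ℝ) : Set (Finset (ℤ × ℤ)) :=
  {S | ∃ r s t : ℝ,
    (∀ z ∈ A, r * z.1 + s * z.2 + t ≤ h z) ∧
    (∀ z, z ∈ S ↔ z ∈ A ∧ r * z.1 + s * z.2 + t = h z) ∧
    ¬ Collinear ℝ (toPlane '' (S : Set (ℤ × ℤ)))}

/-- The honeycomb triangulation of `H_{a,b,c,d}`: slicing with the lines `x = i`, `y = j` and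
`x + y = k`, for integers `i`, `j`, `k`, cuts the polygon into the unit triangles of the two shapes
below; a triangle is given by its three vertices. -/
def honeycombTriangulation (a b c d : ℤ) : Set (Finset (ℤ × ℤ)) :=
  {T | (∃ i j : ℤ, T = {(i, j), (i + 1, j), (i, j + 1)} ∨
        T = {(i + 1, j), (i, j + 1), (i + 1, j + 1)}) ∧
    ∀ z ∈ T, z ∈ latticePoints (honeycombPolygon a b c d)}

/-! ### The skeleton of a triangulation -/

/-- The dual graph of a triangulation: the nodes are the triangles of `Δ`, and two triangles are
adjacent when they share an edge. (Elements outside `Δ` are isolated.) -/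
def dualGraph (Δ : Set (Finset (ℤ × ℤ))) : SimpleGraph (Finset (ℤ × ℤ)) where
  Adj S T := S ∈ Δ ∧ T ∈ Δ ∧ S ≠ T ∧ (S ∩ T).card = 2
  symm := ⟨fun S T h => ⟨h.2.1, h.1, h.2.2.1.symm, by rw [Finset.inter_comm]; exact h.2.2.2⟩⟩
  loopless := ⟨fun _ h => h.2.2.1 rfl⟩

/-- The nodes that disappear when nodes of degree at most one are deleted recursively: a node is
deleted once all its neighbours, with at most one exception, have been deleted. -/
inductive Pruned {V : Type} (G : SimpleGraph V) : V → Prop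
  | leaf (v w : V) (hv : ∀ u, G.Adj v u → u ≠ w → Pruned G u) : Pruned G v

/-- What remains of a graph after the recursive deletion of the nodes of degree one. -/
def coreGraph {V : Type} (G : SimpleGraph V) : SimpleGraph V where
  Adj u v := G.Adj u v ∧ ¬ Pruned G u ∧ ¬ Pruned G v
  symm := ⟨fun _ _ h => ⟨h.1.symm, h.2.2, h.2.1⟩⟩
  loopless := ⟨fun _ h => h.1.ne rfl⟩

/-- Two edges of the pruned graph meet in a node of degree two. -/
def MeetAtTwoValent {V : Type} (G : SimpleGraph V) (e f : (coreGraph G).edgeSet) : Prop :=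
  ∃ v : V, v ∈ (e : Sym2 V) ∧ v ∈ (f : Sym2 V) ∧ ((coreGraph G).neighborSet v).ncard = 2

/-- The edges of the skeleton: the nodes of degree two of the pruned graph are removed and the two
edges at such a node are merged. So an edge of the skeleton is a class of edges of the pruned graph
for the equivalence relation generated by `MeetAtTwoValent`. -/
def SkeletonEdge {V : Type} (G : SimpleGraph V) : Type := Quot (MeetAtTwoValent G)

/-! ### Tropical curves and the cone of metrics -/

/-- The part of the min-plus tropical curve with coefficients `h` on `A` that is dual to a cell with
vertex set `F`: the points `p` of the plane at which the minimum of the quantities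
`z.1 * p.1 + z.2 * p.2 + h z`, for `z` in `A`, is attained at every element of `F`. -/
def tropicalDual (A : Set (ℤ × ℤ)) (h : ℤ × ℤ → ℝ) (F : Set (ℤ × ℤ)) : Set (ℝ × ℝ) :=
  {p | ∀ b ∈ F, ∀ z ∈ A,
    (b.1 : ℝ) * p.1 + (b.2 : ℝ) * p.2 + h b ≤ (z.1 : ℝ) * p.1 + (z.2 : ℝ) * p.2 + h z}

/-- `S` is a segment of rational slope in the plane, of lattice length `l`: it runs from a point `p`
to `p + l • u`, where `u` is a primitive integer vector. -/
def HasLatticeLength (S : Set (ℝ × ℝ)) (l : ℝ) : Prop :=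
  0 ≤ l ∧ ∃ (p : ℝ × ℝ) (u : ℤ × ℤ), IsCoprime u.1 u.2 ∧ S = segment ℝ p (p + l • toPlane u)

/-- The common points of the two triangles that are joined by an edge of the dual graph. -/
def commonFace (e : Sym2 (Finset (ℤ × ℤ))) : Set (ℤ × ℤ) := {b | ∀ T ∈ e, b ∈ T}

/-- The metrics on the skeleton of `Δ` that are realized by the tropical curves dual to `Δ`: the
coefficients `h` of the curve induce the regular subdivision `Δ`, the edge of the curve dual to the
common face of two adjacent triangles has lattice length `l e`, and an edge of the skeleton, which
is a concatenation of edges of the curve, has the sum of their lengths as its length. -/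
def realizedMetrics (A : Set (ℤ × ℤ)) (Δ : Set (Finset (ℤ × ℤ))) :
    Set (SkeletonEdge (dualGraph Δ) → ℝ) :=
  {m | ∃ h : ℤ × ℤ → ℝ, regularSubdivision A h = Δ ∧
    ∃ l : (coreGraph (dualGraph Δ)).edgeSet → ℝ,
      (∀ e : (coreGraph (dualGraph Δ)).edgeSet, HasLatticeLength
        (tropicalDual A h (commonFace (e : Sym2 (Finset (ℤ × ℤ))))) (l e)) ∧
      ∀ E : SkeletonEdge (dualGraph Δ),
        m E = ∑ᶠ (e : (coreGraph (dualGraph Δ)).edgeSet)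
          (_ : Quot.mk (MeetAtTwoValent (dualGraph Δ)) e = E), l e}

/-- The moduli cone `𝕄_Δ`: the closure of the set of metrics on the skeleton that are realized by
tropical curves dual to `Δ`. -/
def moduliCone (A : Set (ℤ × ℤ)) (Δ : Set (Finset (ℤ × ℤ))) :
    Set (SkeletonEdge (dualGraph Δ) → ℝ) :=
  closure (realizedMetrics A Δ)

/-- The dimension of a convex set: the dimension of its affine hull. -/
noncomputable def convexDim {E : Type} [AddCommGroup E] [Module ℝ E] (M : Set E) : ℕ :=
  Module.finrank ℝ (vectorSpan ℝ M)

end TropHoneycomb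

/-! Let A and I be the sets of lattice points of P and of its interior, and let q = x² + xy + y².

Reduction to a rank. If h induces Δ, the curve edge dual to the common edge of two unit triangles
has as lattice length the bend of h: the heights at the two opposite vertices minus those at the two
common ones (`hasLatticeLength_dualEdge`, `latticeLength_unique`). So the skeleton lengths are a
linear function `skeletonMap` of h. Since q induces Δ with a uniform gap, so does q + εδ for every δ
and all small ε > 0 (`exists_perturbation`). Hence the differences of realized metrics span the
whole range of `skeletonMap`, and the dimension is its rank (`IsInner.convexDim_moduliCone`).

Skeleton. Pruning leaves the triangles with a vertex in I. Such a node has degree two iff exactly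
one of its vertices is in I. So a lattice edge inside I gives a skeleton edge of its own, while each
run of consecutive lattice edges from u ∈ I to points outside I gives a single one.

Kernel. Let h vanish on I. The bends in a run telescope, and all skeleton lengths vanish iff (1) for
every edge inside I the heights at the two opposite vertices add up to 0, and (2) at every u ∈ I the
heights at those neighbours that lie, with both cyclically adjacent ones, outside I add up to 0.
Condition (1) has content only at boundary edges of I, condition (2) only at corners. Together with
the values on I this gives independent coordinates (`IsHexagonal.heightCoordinates_surjective`)
through which `skeletonMap` factors, and in these coordinates its kernel consists of the affine
functions.

Count. If I contains a triangle, the kernel is affine on I by propagation across rhombi, of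
dimension 3, and there are as many boundary edges as boundary points. If I consists of n + 1 points
on a segment, there are n edges, 2 corners and a 2-dimensional kernel, and (n + 1) + n + 2 - 2 = (n
+ 1) + (n + 1) + 2 - 3. Finally, boundary points and corners of I are the boundary lattice points
and the vertices of the hull (`IsHexagonal.latticePoints_frontier`,
`IsHexagonal.extremePoints_convexHull`). -/

namespace TropHoneycomb

/-! ### Directions of the triangular lattice -/

/-- The six unit directions of the triangular lattice, in cyclic order. -/
def dir : Fin 6 → ℤ × ℤ := ![(1, 0), (0, 1), (-1, 1), (-1, 0), (0, -1), (1, -1)]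

lemma dir_add_two (k : Fin 6) : dir k + dir (k + 2) = dir (k + 1) := by
  revert k; decide

lemma dir_add_three (k : Fin 6) : dir (k + 3) = -dir k := by
  revert k; decide

lemma dir_injective : Function.Injective dir := by
  intro j k; revert j k; decide

lemma dir_ne_zero (k : Fin 6) : dir k ≠ 0 := by
  revert k; decide

lemma dir_sub_one (k : Fin 6) : dir (k - 1) = dir k - dir (k + 1) := by
  revert k; decide

lemma dir_add_two' (k : Fin 6) : dir (k + 2) = dir (k + 1) - dir k := by
  revert k; decide

/-! ### Hexagonal sets of lattice points -/

/-- A set of lattice points that is cut out by bounds on `x`, `y` and `x + y`. -/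
def IsHexagonal (I : Set (ℤ × ℤ)) : Prop :=
  ∃ α β γ δ σ τ : ℤ, ∀ x y : ℤ, (x, y) ∈ I ↔
    α ≤ x ∧ x ≤ β ∧ γ ≤ y ∧ y ≤ δ ∧ σ ≤ x + y ∧ x + y ≤ τ

/-- Up to sign, order and translation, the forms x, y, x + y of a rotated frame are those of the
original one. This lets every sector be treated as the first. -/
lemma IsHexagonal.frame {I : Set (ℤ × ℤ)} (hI : IsHexagonal I) (u : ℤ × ℤ) (k : Fin 6) :
    IsHexagonal {p | u + p.1 • dir k + p.2 • dir (k + 1) ∈ I} := by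
  obtain ⟨α, β, γ, δ, σ, τ, h⟩ := hI
  obtain ⟨u, v⟩ := u
  fin_cases k
  · refine ⟨α - u, β - u, γ - v, δ - v, σ - u - v, τ - u - v, fun x y => ?_⟩
    simp [dir, h]; omega
  · refine ⟨σ - u - v, τ - u - v, u - β, u - α, γ - v, δ - v, fun x y => ?_⟩
    simp [dir, h]; omega
  · refine ⟨γ - v, δ - v, u + v - τ, u + v - σ, u - β, u - α, fun x y => ?_⟩
    simp [dir, h]; omega
  · refine ⟨u - β, u - α, v - δ, v - γ, u + v - τ, u + v - σ, fun x y => ?_⟩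
    simp [dir, h]; omega
  · refine ⟨u + v - τ, u + v - σ, α - u, β - u, v - δ, v - γ, fun x y => ?_⟩
    simp [dir, h]; omega
  · refine ⟨v - δ, v - γ, σ - u - v, τ - u - v, α - u, β - u, fun x y => ?_⟩
    have : ((5 : Fin 6) + 1) = 0 := rfl
    simp [dir, h, this]; omega

lemma exists_frame (u z : ℤ × ℤ) (k : Fin 6) :
    ∃ x y : ℤ, z = u + x • dir k + y • dir (k + 1) := by
  obtain ⟨u, v⟩ := u
  obtain ⟨z, w⟩ := z
  fin_cases k
  · refine ⟨z - u, w - v, ?_⟩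
    ext <;> simp [dir]
  · refine ⟨z - u + (w - v), u - z, ?_⟩
    ext <;> simp [dir]
    ring
  · refine ⟨w - v, -(z - u) - (w - v), ?_⟩
    ext <;> simp [dir]
    ring
  · refine ⟨u - z, v - w, ?_⟩
    ext <;> simp [dir]
  · refine ⟨-(z - u) - (w - v), z - u, ?_⟩
    ext <;> simp [dir]
    ring
  · refine ⟨v - w, z - u + (w - v), ?_⟩
    have : ((5 : Fin 6) + 1) = 0 := rfl
    ext <;> simp [dir, this]
    ring

section
variable {I : Set (ℤ × ℤ)}

/-- The short diagonal of a rhombus lies in a hexagonal set if the long one does. -/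
lemma IsHexagonal.short_diagonal (hI : IsHexagonal I) {u : ℤ × ℤ} {k : Fin 6}
    (h0 : u + dir k ∈ I) (h2 : u + dir (k + 2) ∈ I) : u ∈ I ∧ u + dir (k + 1) ∈ I := by
  obtain ⟨α, β, γ, δ, σ, τ, h⟩ := hI.frame u k
  have e0 := h 1 0
  have e1 := h 0 0
  have e2 := h 0 1
  have e3 := h (-1) 1
  rw [dir_add_two'] at h2
  simp at e0 e1 e2 e3
  rw [show u + -dir k + dir (k + 1) = u + (dir (k + 1) - dir k) by abel] at e3
  rw [e0] at h0
  rw [e3] at h2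
  rw [e1, e2]
  omega

/-- The same property of a rhombus, labelled from an acute instead of an obtuse vertex. -/
lemma IsHexagonal.short_diagonal' (hI : IsHexagonal I) {u : ℤ × ℤ} {k : Fin 6}
    (h0 : u ∈ I) (h2 : u + dir k + dir (k + 1) ∈ I) :
    u + dir k ∈ I ∧ u + dir (k + 1) ∈ I := by
  obtain ⟨α, β, γ, δ, σ, τ, h⟩ := hI.frame u k
  have e0 := h 1 0
  have e1 := h 0 0
  have e2 := h 0 1
  have e3 := h 1 1
  simp at e0 e1 e2 e3
  rw [e1] at h0
  rw [e3] at h2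
  rw [e0, e2]
  omega

lemma IsHexagonal.midpoint (hI : IsHexagonal I) {u : ℤ × ℤ} {k : Fin 6}
    (h0 : u + dir k ∈ I) (h2 : u + dir (k + 3) ∈ I) : u ∈ I := by
  obtain ⟨α, β, γ, δ, σ, τ, h⟩ := hI.frame u k
  have e0 := h 1 0
  have e1 := h 0 0
  have e2 := h (-1) 0
  rw [dir_add_three] at h2
  simp at e0 e1 e2
  rw [e0] at h0
  rw [e2] at h2
  rw [e1]
  omega

lemma IsHexagonal.exists_neighbor (hI : IsHexagonal I) {u z : ℤ × ℤ} (hu : u ∈ I) (hz : z ∈ I)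
    (hne : z ≠ u) : ∃ k, u + dir k ∈ I := by
  obtain ⟨α, β, γ, δ, σ, τ, h⟩ := hI
  obtain ⟨u, v⟩ := u
  obtain ⟨z, w⟩ := z
  rw [h] at hu hz
  by_contra! hc
  have h0 := hc 0
  have h1 := hc 1
  have h2 := hc 2
  have h3 := hc 3
  have h4 := hc 4
  have h5 := hc 5
  simp [dir, h] at h0 h1 h2 h3 h4 h5
  have : ¬ (z = u ∧ w = v) := fun h => hne (by rw [h.1, h.2])
  omega

/-- A hexagonal set with an edge in direction `dir j` either lies on the line through this edge or
contains a triangle at this edge. -/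
lemma IsHexagonal.on_line (hI : IsHexagonal I) {u z : ℤ × ℤ} {j : Fin 6} (hu : u ∈ I)
    (huj : u + dir j ∈ I) (hz : z ∈ I) :
    u + dir (j + 1) ∈ I ∨ u + dir (j - 1) ∈ I ∨ ∃ i : ℤ, z = u + i • dir j := by
  obtain ⟨x, y, rfl⟩ := exists_frame u z j
  obtain ⟨α, β, γ, δ, σ, τ, h⟩ := hI.frame u j
  have e0 := h 1 0
  have e1 := h 0 0
  have e2 := h 0 1
  have e3 := h 1 (-1)
  have e4 := h x y
  rw [dir_sub_one]
  simp [-zsmul_eq_mul] at e0 e1 e2 e3 e4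
  rw [show u + dir j + -dir (j + 1) = u + (dir j - dir (j + 1)) by abel] at e3
  rw [e1] at hu
  rw [e0] at huj
  rw [e4] at hz
  rw [e2, e3]
  rcases lt_trichotomy y 0 with hy | hy | hy
  · right; left; omega
  · right; right; exact ⟨x, by simp [hy]⟩
  · left; omega

lemma IsHexagonal.line_ordConnected (hI : IsHexagonal I) {p : ℤ × ℤ} {j : Fin 6} {i l k : ℤ}
    (hi : p + i • dir j ∈ I) (hk : p + k • dir j ∈ I) (hil : i ≤ l) (hlk : l ≤ k) :
    p + l • dir j ∈ I := by
  obtain ⟨α, β, γ, δ, σ, τ, h⟩ := hI.frame p j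
  have e0 := h i 0
  have e1 := h l 0
  have e2 := h k 0
  simp [-zsmul_eq_mul] at e0 e1 e2
  rw [e0] at hi
  rw [e2] at hk
  rw [e1]
  omega

lemma eq_zero_of_rhombus_frame {J : Set (ℤ × ℤ)} (hJ : IsHexagonal J) (f : ℤ × ℤ → ℝ)
    (h00 : (0, 0) ∈ J) (h10 : (1, 0) ∈ J) (h01 : (0, 1) ∈ J)
    (f00 : f (0, 0) = 0) (f10 : f (1, 0) = 0) (f01 : f (0, 1) = 0)
    (H0 : ∀ x y : ℤ, (x, y) ∈ J → (x + 1, y) ∈ J → (x, y + 1) ∈ J → (x + 1, y + 1) ∈ J →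
      f (x, y) + f (x + 1, y + 1) = f (x + 1, y) + f (x, y + 1))
    (H1 : ∀ x y : ℤ, (x, y) ∈ J → (x, y + 1) ∈ J → (x - 1, y + 1) ∈ J → (x - 1, y + 2) ∈ J →
      f (x, y) + f (x - 1, y + 2) = f (x, y + 1) + f (x - 1, y + 1))
    (H2 : ∀ x y : ℤ, (x, y) ∈ J → (x + 1, y) ∈ J → (x + 1, y - 1) ∈ J → (x + 2, y - 1) ∈ J →
      f (x, y) + f (x + 2, y - 1) = f (x + 1, y) + f (x + 1, y - 1)) :
    ∀ z ∈ J, f z = 0 := by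
  obtain ⟨α, β, γ, δ, σ, τ, h⟩ := hJ
  -- The measure is three times the total deviation of x, y and x + y from 1/3, 1/3 and 2/3, their
  -- values at the barycentre of the base triangle. Any other point lies in one of six sectors and
  -- completes a rhombus whose remaining vertices have smaller measure and satisfy the bounds of J.
  suffices key : ∀ n : ℕ, ∀ x y : ℤ,
      (3 * x - 1).natAbs + (3 * y - 1).natAbs + (3 * x + 3 * y - 2).natAbs ≤ n →
      (x, y) ∈ J → f (x, y) = 0 from fun z hz => key _ z.1 z.2 le_rfl hz
  intro n
  induction n with
  | zero => intro x y hn; omega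
  | succ n ih =>
    intro x y hn hz
    have hz' := (h x y).1 hz
    rw [h] at h00 h10 h01
    simp only [h] at ih H0 H1 H2
    by_cases c1 : 1 ≤ x ∧ 1 ≤ y
    · have := H0 (x - 1) (y - 1) (by omega) (by omega) (by omega) (by omega)
      simp only [sub_add_cancel] at this
      rw [ih (x - 1) (y - 1) (by omega) (by omega), ih x (y - 1) (by omega) (by omega),
        ih (x - 1) y (by omega) (by omega)] at this
      linarith
    by_cases c2 : 2 ≤ x ∧ 1 ≤ x + y
    · have := H2 (x - 2) (y + 1) (by omega) (by omega) (by omega) (by omega)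
      rw [show x - 2 + 1 = x - 1 by ring, sub_add_cancel, add_sub_cancel_right,
        ih (x - 2) (y + 1) (by omega) (by omega), ih (x - 1) (y + 1) (by omega) (by omega),
        ih (x - 1) y (by omega) (by omega)] at this
      linarith
    by_cases c3 : 1 ≤ x ∧ x + y ≤ 0
    · have := H1 x y (by omega) (by omega) (by omega) (by omega)
      rw [ih x (y + 1) (by omega) (by omega), ih (x - 1) (y + 1) (by omega) (by omega),
        ih (x - 1) (y + 2) (by omega) (by omega)] at this
      linarith
    by_cases c4 : x ≤ 0 ∧ y ≤ 0 ∧ x + y ≤ -1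
    · have := H0 x y (by omega) (by omega) (by omega) (by omega)
      rw [ih (x + 1) y (by omega) (by omega), ih x (y + 1) (by omega) (by omega),
        ih (x + 1) (y + 1) (by omega) (by omega)] at this
      linarith
    by_cases c5 : x ≤ -1 ∧ 1 ≤ y ∧ x + y ≤ 0
    · have := H2 x y (by omega) (by omega) (by omega) (by omega)
      rw [ih (x + 1) y (by omega) (by omega), ih (x + 1) (y - 1) (by omega) (by omega),
        ih (x + 2) (y - 1) (by omega) (by omega)] at this
      linarith
    by_cases c6 : x ≤ 0 ∧ 2 ≤ y ∧ 1 ≤ x + y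
    · have := H1 (x + 1) (y - 2) (by omega) (by omega) (by omega) (by omega)
      rw [show y - 2 + 1 = y - 1 by ring, sub_add_cancel, add_sub_cancel_right,
        ih (x + 1) (y - 2) (by omega) (by omega), ih (x + 1) (y - 1) (by omega) (by omega),
        ih x (y - 1) (by omega) (by omega)] at this
      linarith
    have : (x = 0 ∧ y = 0) ∨ (x = 1 ∧ y = 0) ∨ (x = 0 ∧ y = 1) := by omega
    rcases this with ⟨rfl, rfl⟩ | ⟨rfl, rfl⟩ | ⟨rfl, rfl⟩ <;> assumption

/-- A function on a hexagonal set that vanishes on a triangle and is affine on all rhombi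
vanishes. -/
lemma IsHexagonal.eq_zero_of_rhombus (hI : IsHexagonal I) (f : ℤ × ℤ → ℝ)
    (hf : ∀ v l, v ∈ I → v + dir l ∈ I → v + dir (l + 1) ∈ I → v + dir l + dir (l + 1) ∈ I →
      f v + f (v + dir l + dir (l + 1)) = f (v + dir l) + f (v + dir (l + 1)))
    {u : ℤ × ℤ} {k : Fin 6} (h0 : u ∈ I) (h1 : u + dir k ∈ I) (h2 : u + dir (k + 1) ∈ I)
    (f0 : f u = 0) (f1 : f (u + dir k) = 0) (f2 : f (u + dir (k + 1)) = 0) :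
    ∀ z ∈ I, f z = 0 := by
  intro z hz
  obtain ⟨x, y, rfl⟩ := exists_frame u z k
  have d2 := dir_add_two' k
  have d5 := dir_sub_one k
  refine eq_zero_of_rhombus_frame (hI.frame u k)
    (fun p => f (u + p.1 • dir k + p.2 • dir (k + 1))) (by simpa) (by simpa) (by simpa)
    (by simpa) (by simpa) (by simpa) ?_ ?_ ?_ (x, y) hz
  · intro x y a1 a2 a3 a4
    have e1 : u + (x + 1) • dir k + y • dir (k + 1) =
      u + x • dir k + y • dir (k + 1) + dir k := by module
    have e2 : u + x • dir k + (y + 1) • dir (k + 1) =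
      u + x • dir k + y • dir (k + 1) + dir (k + 1) := by module
    have e3 : u + (x + 1) • dir k + (y + 1) • dir (k + 1) =
      u + x • dir k + y • dir (k + 1) + dir k + dir (k + 1) := by module
    simp only [Set.mem_ofPred_eq, e1, e2, e3] at a1 a2 a3 a4 ⊢
    exact hf _ k a1 a2 a3 a4
  · intro x y a1 a2 a3 a4
    have e1 : u + x • dir k + (y + 1) • dir (k + 1) =
      u + x • dir k + y • dir (k + 1) + dir (k + 1) := by module
    have e2 : u + (x - 1) • dir k + (y + 1) • dir (k + 1) =
      u + x • dir k + y • dir (k + 1) + dir (k + 1 + 1) := by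
        rw [add_assoc k 1 1, show (1 + 1 : Fin 6) = 2 from rfl, d2]; module
    have e3 : u + (x - 1) • dir k + (y + 2) • dir (k + 1) =
      u + x • dir k + y • dir (k + 1) + dir (k + 1) + dir (k + 1 + 1) := by
        rw [add_assoc k 1 1, show (1 + 1 : Fin 6) = 2 from rfl, d2]; module
    simp only [Set.mem_ofPred_eq, e1, e2, e3] at a1 a2 a3 a4 ⊢
    exact hf _ (k + 1) a1 a2 a3 a4
  · intro x y a1 a2 a3 a4
    have e1 : u + (x + 1) • dir k + y • dir (k + 1) =
      u + x • dir k + y • dir (k + 1) + dir (k - 1 + 1) := by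
        rw [sub_add_cancel]; module
    have e2 : u + (x + 1) • dir k + (y - 1) • dir (k + 1) =
      u + x • dir k + y • dir (k + 1) + dir (k - 1) := by rw [d5]; module
    have e3 : u + (x + 2) • dir k + (y - 1) • dir (k + 1) =
      u + x • dir k + y • dir (k + 1) + dir (k - 1) + dir (k - 1 + 1) := by
        rw [sub_add_cancel, d5]; module
    simp only [Set.mem_ofPred_eq, e1, e2, e3] at a1 a2 a3 a4 ⊢
    rw [hf _ (k - 1) a1 a3 a2 a4, add_comm]

end

/-! ### Unit triangles -/

/-- The unit triangle with vertex `u` that lies between the directions `dir k` and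
`dir (k + 1)`. -/
def unitTriangle (u : ℤ × ℤ) (k : Fin 6) : Finset (ℤ × ℤ) := {u, u + dir k, u + dir (k + 1)}

lemma mem_unitTriangle {u z : ℤ × ℤ} {k : Fin 6} :
    z ∈ unitTriangle u k ↔ z = u ∨ z = u + dir k ∨ z = u + dir (k + 1) := by
  simp [unitTriangle]

lemma forall_mem_unitTriangle {u : ℤ × ℤ} {k : Fin 6} {p : ℤ × ℤ → Prop} :
    (∀ z ∈ unitTriangle u k, p z) ↔ p u ∧ p (u + dir k) ∧ p (u + dir (k + 1)) := by
  simp [unitTriangle]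

lemma add_dir_ne (u : ℤ × ℤ) (k : Fin 6) : u + dir k ≠ u := by
  simp [dir_ne_zero]

lemma add_dir_inj {u : ℤ × ℤ} {k l : Fin 6} : u + dir k = u + dir l ↔ k = l := by
  simp [dir_injective.eq_iff]

lemma fin6_add_one_ne (k : Fin 6) : k + 1 ≠ k := by revert k; decide

lemma fin6_sub_one_ne_add_one (k : Fin 6) : k - 1 ≠ k + 1 := by revert k; decide

lemma sum_unitTriangle (u : ℤ × ℤ) (k : Fin 6) (h : ℤ × ℤ → ℝ) :
    ∑ z ∈ unitTriangle u k, h z = h u + h (u + dir k) + h (u + dir (k + 1)) := by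
  rw [unitTriangle, Finset.sum_insert, Finset.sum_insert, Finset.sum_singleton, add_assoc]
  · simp [dir_injective.eq_iff]
  · simp only [Finset.mem_insert, Finset.mem_singleton, not_or]
    exact ⟨(add_dir_ne u k).symm, (add_dir_ne u _).symm⟩

/-- A triangle has three names, one for each root vertex; passing between them shifts the direction
by 2 or 4. -/
lemma unitTriangle_rotate (u : ℤ × ℤ) (k : Fin 6) :
    unitTriangle (u + dir k) (k + 2) = unitTriangle u k := by
  have h1 : u + dir k + dir (k + 2) = u + dir (k + 1) := by rw [add_assoc, dir_add_two]
  have h2 : u + dir k + dir (k + 2 + 1) = u := by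
    rw [show k + 2 + 1 = k + 3 by rw [add_assoc]; rfl, dir_add_three]; abel
  ext z
  rw [mem_unitTriangle, mem_unitTriangle, h1, h2]
  tauto

lemma unitTriangle_rotate' (u : ℤ × ℤ) (k : Fin 6) :
    unitTriangle (u + dir (k + 1)) (k + 4) = unitTriangle u k := by
  have := unitTriangle_rotate (u + dir k) (k + 2)
  rw [add_assoc u, dir_add_two, add_assoc k] at this
  exact this.trans (unitTriangle_rotate u k)

lemma exists_root {u v : ℤ × ℤ} {k : Fin 6} (hv : v ∈ unitTriangle u k) :
    ∃ l, unitTriangle u k = unitTriangle v l := by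
  rcases mem_unitTriangle.1 hv with rfl | rfl | rfl
  · exact ⟨k, rfl⟩
  · exact ⟨k + 2, (unitTriangle_rotate u k).symm⟩
  · exact ⟨k + 4, (unitTriangle_rotate' u k).symm⟩

lemma unitTriangle_inj {u : ℤ × ℤ} {k l : Fin 6} :
    unitTriangle u k = unitTriangle u l ↔ k = l := by
  refine ⟨fun h => ?_, fun h => h ▸ rfl⟩
  have h1 : u + dir k ∈ unitTriangle u l := h ▸ by simp [unitTriangle]
  have h2 : u + dir (k + 1) ∈ unitTriangle u l := h ▸ by simp [unitTriangle]
  simp only [mem_unitTriangle, add_dir_ne, add_dir_inj, false_or] at h1 h2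
  clear h
  revert k l; decide

lemma inter_unitTriangle (u : ℤ × ℤ) (k : Fin 6) :
    unitTriangle u (k - 1) ∩ unitTriangle u k = {u, u + dir k} := by
  have h1 : k - 1 ≠ k := by revert k; decide
  have h2 : k ≠ k + 1 := (fin6_add_one_ne k).symm
  have h3 := fin6_sub_one_ne_add_one k
  ext z
  simp only [Finset.mem_inter, mem_unitTriangle, sub_add_cancel, Finset.mem_insert,
    Finset.mem_singleton]
  constructor
  · rintro ⟨rfl | rfl | rfl, h | h | h⟩ <;> simp_all [dir_ne_zero, dir_injective.eq_iff]
  · rintro (rfl | rfl) <;> simp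

lemma card_inter_unitTriangle (u : ℤ × ℤ) (k : Fin 6) :
    (unitTriangle u (k - 1) ∩ unitTriangle u k).card = 2 := by
  rw [inter_unitTriangle, Finset.card_pair (add_dir_ne u k).symm]

lemma exists_common_edge {u v : ℤ × ℤ} {k l : Fin 6}
    (hne : unitTriangle u k ≠ unitTriangle v l)
    (hcard : (unitTriangle u k ∩ unitTriangle v l).card = 2) :
    ∃ x j, unitTriangle u k = unitTriangle x j ∧ unitTriangle v l = unitTriangle x (j - 1) := by
  obtain ⟨x, hx, y, hy, hxy⟩ := Finset.one_lt_card.1 (hcard.symm ▸ Nat.one_lt_two)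
  rw [Finset.mem_inter] at hx hy
  obtain ⟨j, hj⟩ := exists_root hx.1
  obtain ⟨i, hi⟩ := exists_root hx.2
  rw [hj, hi] at hy hne
  rw [mem_unitTriangle, mem_unitTriangle] at hy
  rw [hj, hi]
  have hji : j ≠ i := fun h => hne (h ▸ rfl)
  rcases hy with ⟨h | h | h, h' | h' | h'⟩
  · exact absurd h.symm hxy
  · exact absurd h.symm hxy
  · exact absurd h.symm hxy
  · exact absurd h'.symm hxy
  · exact absurd (add_dir_inj.1 (h ▸ h')) hji
  · have := add_dir_inj.1 (h ▸ h')
    exact ⟨x, j, rfl, by rw [this, add_sub_cancel_right]⟩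
  · exact absurd h'.symm hxy
  · have := add_dir_inj.1 (h ▸ h')
    -- Here the second triangle follows the first one around x, so the common edge has to be viewed
    -- from its other end.
    refine ⟨x + dir (j + 1), j + 4, (unitTriangle_rotate' x j).symm, ?_⟩
    rw [← this, ← unitTriangle_rotate x (j + 1)]
    congr 1
    clear * -; revert j; decide
  · exact absurd (add_right_cancel (add_dir_inj.1 (h ▸ h'))) hji

lemma neighbor_cases {u : ℤ × ℤ} {k : Fin 6} {v : ℤ × ℤ} {l : Fin 6}
    (hne : unitTriangle u k ≠ unitTriangle v l)
    (hcard : (unitTriangle u k ∩ unitTriangle v l).card = 2) :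
    unitTriangle v l = unitTriangle u (k - 1) ∨ unitTriangle v l = unitTriangle u (k + 1) ∨
      unitTriangle v l = unitTriangle (u + dir k) (k + 1) := by
  obtain ⟨x, j, h1, h2⟩ := exists_common_edge hne hcard
  have hx : x ∈ unitTriangle u k := h1 ▸ by simp [unitTriangle]
  rw [h2]
  rcases mem_unitTriangle.1 hx with rfl | rfl | rfl
  · rw [unitTriangle_inj.1 h1]; exact Or.inl rfl
  · rw [← unitTriangle_rotate, unitTriangle_inj] at h1
    rw [← h1]
    right; right; congr 1
    clear * -; revert k; decide
  · rw [← unitTriangle_rotate', unitTriangle_inj] at h1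
    rw [← h1, ← unitTriangle_rotate u (k + 1)]
    right; left; congr 1
    clear * -; revert k; decide

/-! ### The dual graph -/

/-- All unit triangles with vertices in `A`. -/
def unitTriangulation (A : Set (ℤ × ℤ)) : Set (Finset (ℤ × ℤ)) :=
  {T | ∃ u k, T = unitTriangle u k ∧ ∀ z ∈ T, z ∈ A}

lemma unitTriangle_mem {A : Set (ℤ × ℤ)} {u : ℤ × ℤ} {k : Fin 6} :
    unitTriangle u k ∈ unitTriangulation A ↔ u ∈ A ∧ u + dir k ∈ A ∧ u + dir (k + 1) ∈ A := by
  rw [← forall_mem_unitTriangle (p := fun z => z ∈ A)]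
  exact ⟨fun ⟨_, _, _, h⟩ => h, fun h => ⟨u, k, rfl, h⟩⟩

/-- `I` behaves in `A` like the set of interior lattice points of a honeycomb polygon behaves in
the set of its lattice points. -/
structure IsInner (A I : Set (ℤ × ℤ)) : Prop where
  finite : A.Finite
  hex : IsHexagonal I
  subset : I ⊆ A
  neighbor : ∀ u ∈ I, ∀ k, u + dir k ∈ A
  corner : ∀ u k, u ∈ A → u + dir (k - 1) ∈ A → u + dir k ∈ A → u + dir (k + 1) ∈ A →
    u + dir (k + 2) ∈ A → u ∈ I ∨ u + dir k ∈ I ∨ u + dir (k + 1) ∈ I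

variable {A I : Set (ℤ × ℤ)}

lemma dualGraph_adj_unitTriangle {u : ℤ × ℤ} {k : Fin 6}
    (h1 : unitTriangle u (k - 1) ∈ unitTriangulation A)
    (h2 : unitTriangle u k ∈ unitTriangulation A) :
    (dualGraph (unitTriangulation A)).Adj (unitTriangle u (k - 1)) (unitTriangle u k) :=
  ⟨h1, h2, fun h => by
    have := unitTriangle_inj.1 h
    clear * - this; revert k; decide, card_inter_unitTriangle u k⟩

lemma dualGraph_adj_cases {u : ℤ × ℤ} {k : Fin 6} {S : Finset (ℤ × ℤ)}
    (h : (dualGraph (unitTriangulation A)).Adj (unitTriangle u k) S) :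
    S = unitTriangle u (k - 1) ∨ S = unitTriangle u (k + 1) ∨
      S = unitTriangle (u + dir k) (k + 1) := by
  obtain ⟨-, ⟨v, l, rfl, -⟩, h3, h4⟩ := h
  exact neighbor_cases h3 h4

lemma IsInner.mem_triangulation (hA : IsInner A I) {u : ℤ × ℤ} (hu : u ∈ I) (k : Fin 6) :
    unitTriangle u k ∈ unitTriangulation A :=
  unitTriangle_mem.2 ⟨hA.subset hu, hA.neighbor u hu k, hA.neighbor u hu _⟩

/-- The six triangles around a point of I form a cycle in the dual graph. None can be deleted first:
at least one of its two neighbours in the cycle differs from the exempted node. -/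
lemma IsInner.not_pruned (hA : IsInner A I) {T : Finset (ℤ × ℤ)}
    (hT : Pruned (dualGraph (unitTriangulation A)) T) :
    ∀ u ∈ I, ∀ k, T ≠ unitTriangle u k := by
  induction hT with
  | leaf T w _ ih =>
    rintro u hu k rfl
    have a1 := (dualGraph_adj_unitTriangle (hA.mem_triangulation hu (k - 1))
      (hA.mem_triangulation hu k)).symm
    have a2 := dualGraph_adj_unitTriangle (hA.mem_triangulation hu (k + 1 - 1))
      (hA.mem_triangulation hu (k + 1))
    rw [add_sub_cancel_right] at a2
    by_cases hw : unitTriangle u (k - 1) = w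
    · refine ih _ a2 (fun h => ?_) u hu (k + 1) rfl
      exact fin6_sub_one_ne_add_one k (unitTriangle_inj.1 (hw.trans h.symm))
    · exact ih _ a1 hw u hu (k - 1) rfl

/-- One round of pruning suffices. By `corner`, used at each of the three vertices, a triangle with
two neighbours has a vertex in I; without such a vertex it is isolated or a leaf. -/
lemma IsInner.pruned (hA : IsInner A I) {T : Finset (ℤ × ℤ)} (hT : ∀ z ∈ T, z ∉ I) :
    Pruned (dualGraph (unitTriangulation A)) T := by
  by_cases hN : ∃ w, (dualGraph (unitTriangulation A)).Adj T w
  swap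
  · exact Pruned.leaf T T fun u hu => absurd ⟨u, hu⟩ hN
  obtain ⟨w, hw⟩ := hN
  refine Pruned.leaf T w fun S hS hne => ?_
  exfalso
  obtain ⟨u, k, rfl, -⟩ := id hS.1
  have m1 := unitTriangle_mem.1 hS.1
  rw [forall_mem_unitTriangle] at hT
  have c1 := hA.corner u k
  have c2 := hA.corner (u + dir k) (k + 2)
  have c3 := hA.corner (u + dir (k + 1)) (k + 4)
  have e1 : u + dir k + dir (k + 2 - 1) = u + dir k + dir (k + 1) := by
    rw [add_sub_assoc]; rfl
  have e2 : u + dir k + dir (k + 2) = u + dir (k + 1) := by rw [add_assoc, dir_add_two]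
  have e3 : u + dir k + dir (k + 2 + 1) = u := by
    rw [add_assoc k, show (2 + 1 : Fin 6) = 3 from rfl, dir_add_three]; abel
  have e4 : u + dir k + dir (k + 2 + 2) = u + dir (k - 1) := by
    rw [add_assoc k, add_assoc u]; congr 1; clear * -; revert k; decide
  have e5 : u + dir (k + 1) + dir (k + 4 - 1) = u + dir (k + 2) := by
    rw [add_assoc u]; congr 1; clear * -; revert k; decide
  have e6 : u + dir (k + 1) + dir (k + 4) = u := by
    rw [add_assoc u, add_eq_left]; clear * -; revert k; decide
  have e7 : u + dir (k + 1) + dir (k + 4 + 1) = u + dir k := by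
    rw [add_assoc u]; congr 1; clear * -; revert k; decide
  have e8 : u + dir (k + 1) + dir (k + 4 + 2) = u + dir k + dir (k + 1) := by
    rw [add_assoc u, add_assoc u]; congr 1; clear * -; revert k; decide
  rw [e1, e2, e3, e4] at c2
  rw [e5, e6, e7, e8] at c3
  have n1 : ∀ {S}, (dualGraph (unitTriangulation A)).Adj (unitTriangle u k) S →
      S = unitTriangle u (k - 1) ∧ u + dir (k - 1) ∈ A ∨
      S = unitTriangle u (k + 1) ∧ u + dir (k + 2) ∈ A ∨
      S = unitTriangle (u + dir k) (k + 1) ∧ u + dir k + dir (k + 1) ∈ A := by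
    intro S hS
    have hS' := hS.2.1
    rcases dualGraph_adj_cases hS with h | h | h
    · exact Or.inl ⟨h, (unitTriangle_mem.1 (h ▸ hS')).2.1⟩
    · refine Or.inr (Or.inl ⟨h, ?_⟩)
      have := (unitTriangle_mem.1 (h ▸ hS')).2.2
      rwa [add_assoc k] at this
    · exact Or.inr (Or.inr ⟨h, (unitTriangle_mem.1 (h ▸ hS')).2.1⟩)
  rcases n1 hS with ⟨h, h'⟩ | ⟨h, h'⟩ | ⟨h, h'⟩ <;>
    rcases n1 hw with ⟨g, g'⟩ | ⟨g, g'⟩ | ⟨g, g'⟩ <;>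
    first
      | exact hne (h.trans g.symm)
      | tauto

/-- The nodes of the pruned dual graph are the triangles with an interior vertex. -/
lemma IsInner.coreGraph_adj (hA : IsInner A I) {S T : Finset (ℤ × ℤ)} :
    (coreGraph (dualGraph (unitTriangulation A))).Adj S T ↔
      (dualGraph (unitTriangulation A)).Adj S T ∧ (∃ z ∈ S, z ∈ I) ∧ ∃ z ∈ T, z ∈ I := by
  have key : ∀ {T}, T ∈ unitTriangulation A →
      (¬ Pruned (dualGraph (unitTriangulation A)) T ↔ ∃ z ∈ T, z ∈ I) := by
    rintro T ⟨u, k, rfl, -⟩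
    constructor
    · intro h
      by_contra! h'
      exact h (hA.pruned h')
    · rintro ⟨z, hz, hzI⟩ hp
      obtain ⟨l, hl⟩ := exists_root hz
      exact hA.not_pruned hp z hzI l hl
  constructor
  · rintro ⟨h1, h2, h3⟩
    exact ⟨h1, (key h1.1).1 h2, (key h1.2.1).1 h3⟩
  · rintro ⟨h1, h2, h3⟩
    exact ⟨h1, (key h1.1).2 h2, (key h1.2.1).2 h3⟩

/-- The edge of the dual graph that crosses the lattice edge from `u` in direction `dir k`. -/
def dualEdge (u : ℤ × ℤ) (k : Fin 6) : Sym2 (Finset (ℤ × ℤ)) :=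
  s(unitTriangle u (k - 1), unitTriangle u k)

lemma dualEdge_reverse (u : ℤ × ℤ) (k : Fin 6) :
    dualEdge (u + dir k) (k + 3) = dualEdge u k := by
  have h1 := unitTriangle_rotate' u (k - 1)
  have h2 := unitTriangle_rotate u k
  rw [sub_add_cancel, show k - 1 + 4 = k + 3 by clear h2 h1; revert k; decide] at h1
  rw [dualEdge, dualEdge, h1, add_sub_assoc, show (3 - 1 : Fin 6) = 2 from rfl, h2, Sym2.eq_swap]

lemma commonFace_dualEdge (u : ℤ × ℤ) (k : Fin 6) :
    commonFace (dualEdge u k) = {u, u + dir k} := by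
  have := inter_unitTriangle u k
  ext z
  have := Finset.ext_iff.1 this z
  simp only [Finset.mem_inter, Finset.mem_insert, Finset.mem_singleton] at this
  simp [commonFace, dualEdge, this]

lemma IsInner.dualEdge_mem (hA : IsInner A I) {u : ℤ × ℤ} (hu : u ∈ I) (k : Fin 6) :
    dualEdge u k ∈ (coreGraph (dualGraph (unitTriangulation A))).edgeSet := by
  rw [dualEdge, SimpleGraph.mem_edgeSet, hA.coreGraph_adj]
  exact ⟨dualGraph_adj_unitTriangle (hA.mem_triangulation hu _) (hA.mem_triangulation hu _),
    ⟨u, by simp [unitTriangle], hu⟩, ⟨u, by simp [unitTriangle], hu⟩⟩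

lemma IsInner.exists_dualEdge (hA : IsInner A I) {e : Sym2 (Finset (ℤ × ℤ))}
    (he : e ∈ (coreGraph (dualGraph (unitTriangulation A))).edgeSet) :
    ∃ u ∈ I, ∃ k, e = dualEdge u k := by
  induction e with
  | _ T S =>
  rw [SimpleGraph.mem_edgeSet, hA.coreGraph_adj] at he
  obtain ⟨⟨⟨u, k, rfl, -⟩, ⟨v, l, rfl, -⟩, h1, h2⟩, h3, h4⟩ := he
  obtain ⟨x, j, hx, hy⟩ := exists_common_edge h1 h2
  rw [hx] at h3 ⊢
  rw [hy] at h4 ⊢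
  rw [Sym2.eq_swap]
  by_cases hxI : x ∈ I
  · exact ⟨x, hxI, j, rfl⟩
  by_cases hxj : x + dir j ∈ I
  · exact ⟨_, hxj, j + 3, (dualEdge_reverse x j).symm⟩
  -- If neither end of the common edge is in I, both opposite vertices are, and this long diagonal
  -- of a rhombus forces the short one into I.
  exfalso
  simp only [mem_unitTriangle, sub_add_cancel, exists_eq_or_imp, exists_eq_left, hxI, hxj,
    false_or, or_false] at h3 h4
  refine hxI (hA.hex.short_diagonal h4 ?_).1
  rwa [show j - 1 + 2 = j + 1 by clear * -; revert j; decide]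

/-- The crossed lattice edge is recovered as the common face, and u is its only end in I. -/
lemma dualEdge_injOn {u v : ℤ × ℤ} {k l : Fin 6} (hu : u ∈ I) (hv : v ∈ I)
    (huk : u + dir k ∉ I) (h : dualEdge u k = dualEdge v l) : u = v ∧ k = l := by
  have h' := congrArg commonFace h
  rw [commonFace_dualEdge, commonFace_dualEdge] at h'
  have h1 : v ∈ ({u, u + dir k} : Set (ℤ × ℤ)) := h' ▸ by simp
  have h2 : u + dir k ∈ ({v, v + dir l} : Set (ℤ × ℤ)) := h' ▸ by simp
  rcases h1 with rfl | rfl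
  · rcases h2 with h2 | h2
    · exact absurd h2 (add_dir_ne _ _)
    · exact ⟨rfl, add_dir_inj.1 h2⟩
  · exact absurd hv huk

lemma IsInner.neighborSet_core (hA : IsInner A I) {u : ℤ × ℤ} (hu : u ∈ I) (k : Fin 6) :
    (coreGraph (dualGraph (unitTriangulation A))).neighborSet (unitTriangle u k) =
      {unitTriangle u (k - 1), unitTriangle u (k + 1)} ∪
        {S | S = unitTriangle (u + dir k) (k + 1) ∧ (u + dir k ∈ I ∨ u + dir (k + 1) ∈ I)} := by
  have hT : ∀ l, ∃ z ∈ unitTriangle u l, z ∈ I := fun l => ⟨u, by simp [unitTriangle], hu⟩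
  have e2 : u + dir k + dir (k + 1 + 1) = u + dir (k + 1) := by
    rw [add_assoc k, add_assoc u, show (1 + 1 : Fin 6) = 2 from rfl, dir_add_two]
  ext S
  rw [SimpleGraph.mem_neighborSet, hA.coreGraph_adj]
  simp only [Set.mem_union, Set.mem_insert_iff, Set.mem_singleton_iff, Set.mem_ofPred_eq]
  constructor
  · rintro ⟨h1, -, h3⟩
    rcases dualGraph_adj_cases h1 with h | h | h
    · exact Or.inl (Or.inl h)
    · exact Or.inl (Or.inr h)
    · refine Or.inr ⟨h, ?_⟩
      subst h
      simp only [mem_unitTriangle, exists_eq_or_imp, exists_eq_left, e2] at h3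
      rcases h3 with h | h | h
      · exact Or.inl h
      · exact Or.inl (hA.hex.short_diagonal' hu h).1
      · exact Or.inr h
  · rintro ((rfl | rfl) | ⟨rfl, h⟩)
    · exact ⟨(dualGraph_adj_unitTriangle (hA.mem_triangulation hu _)
        (hA.mem_triangulation hu _)).symm, hT _, hT _⟩
    · have := dualGraph_adj_unitTriangle (hA.mem_triangulation hu (k + 1 - 1))
        (hA.mem_triangulation hu (k + 1))
      rw [add_sub_cancel_right] at this
      exact ⟨this, hT _, hT _⟩
    · have h1 : unitTriangle (u + dir k) (k + 1) ∈ unitTriangulation A := by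
        rcases h with h | h
        · exact hA.mem_triangulation h _
        · rw [← unitTriangle_rotate', e2]
          exact hA.mem_triangulation h _
      refine ⟨?_, hT _, ?_⟩
      · rw [← unitTriangle_rotate u k]
        have := dualGraph_adj_unitTriangle (u := u + dir k) (k := k + 2)
          (by rwa [add_sub_assoc]) (by rw [unitTriangle_rotate]; exact hA.mem_triangulation hu _)
        rw [add_sub_assoc] at this
        exact this.symm
      · simp only [mem_unitTriangle, exists_eq_or_imp, exists_eq_left, e2]
        tauto

lemma IsInner.ncard_neighborSet_core (hA : IsInner A I) {u : ℤ × ℤ} (hu : u ∈ I) (k : Fin 6) :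
    ((coreGraph (dualGraph (unitTriangulation A))).neighborSet (unitTriangle u k)).ncard = 2 ↔
      u + dir k ∉ I ∧ u + dir (k + 1) ∉ I := by
  have hne : unitTriangle u (k - 1) ≠ unitTriangle u (k + 1) :=
    fun h => fin6_sub_one_ne_add_one k (unitTriangle_inj.1 h)
  rw [hA.neighborSet_core hu k]
  by_cases h : u + dir k ∈ I ∨ u + dir (k + 1) ∈ I
  · have huT : ∀ l, u ∈ unitTriangle u l := fun l => by simp [unitTriangle]
    have hu' : u ∉ unitTriangle (u + dir k) (k + 1) := by
      rw [mem_unitTriangle, add_assoc, add_assoc, add_assoc k]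
      simp only [left_eq_add]
      clear * -; revert k; decide
    have h1 : ∀ l, unitTriangle u l ≠ unitTriangle (u + dir k) (k + 1) :=
      fun l hl => hu' (hl ▸ huT l)
    simp only [h, and_true, ← not_or, not_true, iff_false]
    rw [show ({unitTriangle u (k - 1), unitTriangle u (k + 1)} ∪
      {S | S = unitTriangle (u + dir k) (k + 1)} : Set (Finset (ℤ × ℤ))) =
      {unitTriangle u (k - 1), unitTriangle u (k + 1), unitTriangle (u + dir k) (k + 1)} by
        ext; simp; tauto, Set.ncard_eq_three.2 ⟨_, _, _, hne, h1 _, h1 _, rfl⟩]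
    decide
  · simp only [h, and_false, ← not_or, not_false_iff, iff_true]
    rw [show ({S | False} : Set (Finset (ℤ × ℤ))) = ∅ by ext; simp, Set.union_empty]
    exact Set.ncard_pair hne

lemma IsInner.edge_cases (hA : IsInner A I) {u : ℤ × ℤ} (hu : u ∈ I) {k : Fin 6}
    (h1 : u + dir k ∉ I) (h2 : u + dir (k + 1) ∉ I) {e : Sym2 (Finset (ℤ × ℤ))}
    (he : e ∈ (coreGraph (dualGraph (unitTriangulation A))).edgeSet)
    (hT : unitTriangle u k ∈ e) : e = dualEdge u k ∨ e = dualEdge u (k + 1) := by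
  obtain ⟨S, rfl⟩ := Sym2.mem_iff_exists.1 hT
  rw [SimpleGraph.mem_edgeSet, ← SimpleGraph.mem_neighborSet, hA.neighborSet_core hu k] at he
  simp only [h1, h2, or_self, and_false, Set.mem_union, Set.mem_insert_iff,
    Set.mem_singleton_iff, Set.mem_ofPred_eq, or_false] at he
  rcases he with rfl | rfl
  · exact Or.inl Sym2.eq_swap
  · rw [dualEdge, dualEdge, add_sub_cancel_right]
    exact Or.inr rfl

/-- Two edges of the pruned dual graph are merged at a two-valent node precisely if they cross
consecutive lattice edges that go from an interior point to two boundary points. -/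
lemma IsInner.meetAtTwoValent_iff (hA : IsInner A I)
    {e f : (coreGraph (dualGraph (unitTriangulation A))).edgeSet} :
    MeetAtTwoValent (dualGraph (unitTriangulation A)) e f ↔
      ∃ u ∈ I, ∃ k, u + dir k ∉ I ∧ u + dir (k + 1) ∉ I ∧
        ((e : Sym2 _) = dualEdge u k ∨ (e : Sym2 _) = dualEdge u (k + 1)) ∧
        ((f : Sym2 _) = dualEdge u k ∨ (f : Sym2 _) = dualEdge u (k + 1)) := by
  constructor
  · rintro ⟨T, hTe, hTf, hT⟩
    obtain ⟨S, hS⟩ := Sym2.mem_iff_exists.1 hTe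
    have he := e.2
    rw [hS, SimpleGraph.mem_edgeSet, hA.coreGraph_adj] at he
    obtain ⟨⟨⟨v, l, rfl, -⟩, -⟩, ⟨u, hu, huI⟩, -⟩ := he
    obtain ⟨k, hk⟩ := exists_root hu
    rw [hk] at hT hTe hTf
    rw [hA.ncard_neighborSet_core huI] at hT
    exact ⟨u, huI, k, hT.1, hT.2, hA.edge_cases huI hT.1 hT.2 e.2 hTe,
      hA.edge_cases huI hT.1 hT.2 f.2 hTf⟩
  · rintro ⟨u, hu, k, h1, h2, he, hf⟩
    have key : ∀ {e}, e = dualEdge u k ∨ e = dualEdge u (k + 1) → unitTriangle u k ∈ e := by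
      rintro e (rfl | rfl) <;> simp [dualEdge]
    exact ⟨unitTriangle u k, key he, key hf, (hA.ncard_neighborSet_core hu k).2 ⟨h1, h2⟩⟩

/-! ### Summation over the classes of a quotient -/

section QuotSum
variable {E : Type} [Finite E] (r : E → E → Prop)

open Classical in
/-- The sums of a function over the classes of the equivalence relation generated by `r`. -/
noncomputable def quotSum : (E → ℝ) →ₗ[ℝ] (Quot r → ℝ) where
  toFun m q := ∑ᶠ e, if Quot.mk r e = q then m e else 0
  map_add' m m' := by
    have := Fintype.ofFinite E
    ext q
    simp only [finsum_eq_sum_of_fintype, Pi.add_apply, ← Finset.sum_add_distrib]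
    exact Finset.sum_congr rfl fun e _ => by split_ifs <;> simp
  map_smul' c m := by
    have := Fintype.ofFinite E
    ext q
    simp only [finsum_eq_sum_of_fintype, Pi.smul_apply, smul_eq_mul, Finset.mul_sum,
      RingHom.id_apply]
    exact Finset.sum_congr rfl fun e _ => by split_ifs <;> simp

lemma quotSum_apply (m : E → ℝ) (q : Quot r) :
    quotSum r m q = ∑ᶠ (e : E) (_ : Quot.mk r e = q), m e := by
  classical
  exact finsum_congr fun e => (finsum_eq_if).symm

/-- Testing against functions that are constant on classes, in particular indicators of classes,
avoids any explicit description of the classes. -/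
lemma quotSum_eq_zero_iff (m : E → ℝ) :
    quotSum r m = 0 ↔
      ∀ w : E → ℝ, (∀ e f, r e f → w e = w f) → ∑ᶠ e, w e * m e = 0 := by
  classical
  have := Fintype.ofFinite E
  have := Fintype.ofFinite (Quot r)
  constructor
  · intro h w hw
    rw [finsum_eq_sum_of_fintype]
    have h1 : ∑ q : Quot r, Quot.lift w hw q * quotSum r m q = ∑ e, w e * m e := by
      simp only [quotSum, LinearMap.coe_mk, AddHom.coe_mk, finsum_eq_sum_of_fintype,
        Finset.mul_sum]
      rw [Finset.sum_comm]
      refine Finset.sum_congr rfl fun e _ => ?_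
      rw [Finset.sum_eq_single (Quot.mk r e)]
      · simp
      · intro q _ hq
        simp [hq.symm]
      · simp
    rw [← h1, h]
    simp
  · intro h
    ext q
    have := h (fun e => if Quot.mk r e = q then 1 else 0) fun e f hef => by
      rw [Quot.sound hef]
    simpa [quotSum, ite_mul] using this

end QuotSum

/-! ### The linear map that sends heights to lengths -/

/-- The amount by which a height function bends along the common edge of two triangles. -/
def bend (h : ℤ × ℤ → ℝ) : Sym2 (Finset (ℤ × ℤ)) → ℝ :=
  -- The common vertices occur in both of the first sums, so the factor 3 leaves them with weight
  -- -1.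
  Sym2.lift ⟨fun S T => ∑ z ∈ S, h z + ∑ z ∈ T, h z - 3 * ∑ z ∈ S ∩ T, h z,
    fun S T => by dsimp only; rw [Finset.inter_comm, add_comm (∑ z ∈ S, h z)]⟩

lemma bend_dualEdge (h : ℤ × ℤ → ℝ) (u : ℤ × ℤ) (k : Fin 6) :
    bend h (dualEdge u k) =
      h (u + dir (k - 1)) + h (u + dir (k + 1)) - h u - h (u + dir k) := by
  rw [bend, dualEdge, Sym2.lift_mk]
  simp only [inter_unitTriangle, sum_unitTriangle, sub_add_cancel]
  rw [Finset.sum_pair (add_dir_ne u k).symm]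
  ring

lemma bend_add (h h' : ℤ × ℤ → ℝ) (e : Sym2 (Finset (ℤ × ℤ))) :
    bend (h + h') e = bend h e + bend h' e := by
  induction e with
  | _ S T => simp only [bend, Sym2.lift_mk, Pi.add_apply, Finset.sum_add_distrib]; ring

lemma bend_smul (c : ℝ) (h : ℤ × ℤ → ℝ) (e : Sym2 (Finset (ℤ × ℤ))) :
    bend (c • h) e = c * bend h e := by
  induction e with
  | _ S T =>
    simp only [bend, Sym2.lift_mk, Pi.smul_apply, smul_eq_mul, ← Finset.mul_sum]; ring

/-- The linear map that sends a height function to its bends along the edges of the pruned dual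
graph. -/
def bendMap (A : Set (ℤ × ℤ)) :
    (ℤ × ℤ → ℝ) →ₗ[ℝ] ((coreGraph (dualGraph (unitTriangulation A))).edgeSet → ℝ) where
  toFun h e := bend h e
  map_add' h h' := funext fun e => bend_add h h' e
  map_smul' c h := funext fun e => bend_smul c h e

/-- The linear map that sends a height function to the lengths of the skeleton edges. -/
noncomputable def skeletonMap (A : Set (ℤ × ℤ))
    [Finite (coreGraph (dualGraph (unitTriangulation A))).edgeSet] :
    (ℤ × ℤ → ℝ) →ₗ[ℝ] (SkeletonEdge (dualGraph (unitTriangulation A)) → ℝ) where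
  toFun h := quotSum (MeetAtTwoValent (dualGraph (unitTriangulation A))) (bendMap A h)
  map_add' h h' :=
    map_add ((quotSum (MeetAtTwoValent (dualGraph (unitTriangulation A)))).comp (bendMap A)) h h'
  map_smul' c h :=
    map_smul ((quotSum (MeetAtTwoValent (dualGraph (unitTriangulation A)))).comp (bendMap A)) c h

lemma skeletonMap_apply [Finite (coreGraph (dualGraph (unitTriangulation A))).edgeSet]
    (h : ℤ × ℤ → ℝ) (q : SkeletonEdge (dualGraph (unitTriangulation A))) :
    skeletonMap A h q = ∑ᶠ (e : (coreGraph (dualGraph (unitTriangulation A))).edgeSet)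
      (_ : Quot.mk (MeetAtTwoValent (dualGraph (unitTriangulation A))) e = q), bend h e :=
  quotSum_apply _ (bendMap A h) q

lemma IsInner.finite_edgeSet (hA : IsInner A I) :
    Finite (coreGraph (dualGraph (unitTriangulation A))).edgeSet := by
  have hI : I.Finite := hA.finite.subset hA.subset
  refine ((hI.prod (Set.finite_univ (α := Fin 6))).image
    fun p => dualEdge p.1 p.2).subset fun e he => ?_
  obtain ⟨u, hu, k, rfl⟩ := hA.exists_dualEdge he
  exact ⟨(u, k), ⟨hu, trivial⟩, rfl⟩

-- Merging never involves an edge inside I, and it relates outgoing edges only when they have the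
-- same end in I. So weights that are constant on skeleton edges can be prescribed separately on the
-- edges inside I and on the runs around each u.
open Classical in
lemma IsInner.skeletonMap_eq_zero_iff (hA : IsInner A I)
    [Finite (coreGraph (dualGraph (unitTriangulation A))).edgeSet] (h : ℤ × ℤ → ℝ) :
    skeletonMap A h = 0 ↔
      (∀ u ∈ I, ∀ k, u + dir k ∈ I → bend h (dualEdge u k) = 0) ∧
      ∀ u ∈ I, ∀ w : Fin 6 → ℝ,
        (∀ k, u + dir k ∉ I → u + dir (k + 1) ∉ I → w k = w (k + 1)) →
        ∑ k, (if u + dir k ∈ I then 0 else w k * bend h (dualEdge u k)) = 0 := by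
  have := Fintype.ofFinite (coreGraph (dualGraph (unitTriangulation A))).edgeSet
  have hIf : Finite I := (hA.finite.subset hA.subset).to_subtype
  have := Fintype.ofFinite I
  refine (quotSum_eq_zero_iff (MeetAtTwoValent (dualGraph (unitTriangulation A)))
    (bendMap A h)).trans ?_
  simp only [bendMap, LinearMap.coe_mk, AddHom.coe_mk, finsum_eq_sum_of_fintype]
  constructor
  · intro H
    constructor
    · intro u hu k huk
      have := H (fun e => if (e : Sym2 _) = dualEdge u k then 1 else 0) fun e f hef => by
        obtain ⟨v, hv, l, h1, h2, he, hf⟩ := hA.meetAtTwoValent_iff.1 hef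
        have key : ∀ {e : Sym2 _}, (e = dualEdge v l ∨ e = dualEdge v (l + 1)) →
            e ≠ dualEdge u k := by
          rintro _ (rfl | rfl) h'
          · obtain ⟨rfl, rfl⟩ := dualEdge_injOn hv hu h1 h'
            exact h1 huk
          · obtain ⟨rfl, rfl⟩ := dualEdge_injOn hv hu h2 h'
            exact h2 huk
        simp only [key he, key hf]
      rw [Finset.sum_eq_single ⟨dualEdge u k, hA.dualEdge_mem hu k⟩] at this
      · simpa using this
      · rintro ⟨e, he⟩ - hne
        simp only [ne_eq, Subtype.mk.injEq] at hne
        simp [hne]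
      · simp
    · intro u hu w hw
      -- The weights at u are extended by zero to all other edges. At most one summand survives,
      -- since an outgoing edge determines its direction at u.
      set W : Sym2 (Finset (ℤ × ℤ)) → ℝ := fun e =>
        ∑ k, if u + dir k ∉ I ∧ e = dualEdge u k then w k else 0 with hW
      have hW1 : ∀ v ∈ I, ∀ l, v + dir l ∉ I → W (dualEdge v l) = if u = v then w l else 0 := by
        intro v hv l hl
        by_cases huv : u = v
        · subst huv
          rw [if_pos rfl, hW]
          dsimp only
          rw [Finset.sum_eq_single l]
          · simp [hl]
          · intro k _ hk
            rw [if_neg]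
            rintro ⟨h1, h2⟩
            exact hk (dualEdge_injOn hu hu hl h2).2.symm
          · simp
        · rw [if_neg huv, hW]
          refine Finset.sum_eq_zero fun k _ => ?_
          rw [if_neg]
          rintro ⟨h1, h2⟩
          exact huv (dualEdge_injOn hv hu hl h2).1.symm
      have := H (fun e => W e) fun e f hef => by
        obtain ⟨v, hv, l, h1, h2, he, hf⟩ := hA.meetAtTwoValent_iff.1 hef
        have key : ∀ {e : Sym2 _}, (e = dualEdge v l ∨ e = dualEdge v (l + 1)) →
            W e = if u = v then w l else 0 := by
          rintro _ (rfl | rfl)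
          · exact hW1 v hv l h1
          · rw [hW1 v hv _ h2]
            split_ifs with huv
            · subst huv
              exact (hw l h1 h2).symm
            · rfl
        rw [key he, key hf]
      refine Eq.trans ?_ this
      simp only [hW, Finset.sum_mul]
      rw [Finset.sum_comm]
      refine Finset.sum_congr rfl fun k _ => ?_
      rw [Finset.sum_eq_single ⟨dualEdge u k, hA.dualEdge_mem hu k⟩]
      · by_cases huk : u + dir k ∈ I <;> simp [huk]
      · rintro ⟨e, he⟩ - hne
        simp only [ne_eq, Subtype.mk.injEq] at hne
        simp [hne]
      · simp
  · rintro ⟨H1, H2⟩ w hw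
    -- Edges inside I contribute nothing by `H1`; the others are indexed without repetition by their
    -- end in I and their direction.
    have h1 : ∑ p ∈ (Finset.univ : Finset (I × Fin 6)).filter
          (fun p => (p.1 : ℤ × ℤ) + dir p.2 ∉ I),
        w ⟨dualEdge p.1 p.2, hA.dualEdge_mem p.1.2 p.2⟩ * bend h (dualEdge p.1 p.2) =
        ∑ e, w e * bend h e := by
      refine Finset.sum_of_injOn
        (fun p : I × Fin 6 => ⟨dualEdge p.1 p.2, hA.dualEdge_mem p.1.2 p.2⟩) ?_ ?_ ?_ ?_
      · rintro ⟨⟨u, hu⟩, k⟩ hp ⟨⟨v, hv⟩, l⟩ - heq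
        simp only [Subtype.mk.injEq] at heq
        simp only [Finset.coe_filter, Finset.mem_univ, true_and, Set.mem_ofPred_eq] at hp
        obtain ⟨rfl, rfl⟩ := dualEdge_injOn hu hv hp heq
        rfl
      · intro p _
        simp
      · rintro ⟨e, he⟩ - hne
        obtain ⟨u, hu, k, rfl⟩ := hA.exists_dualEdge he
        by_cases huk : u + dir k ∈ I
        · simp [H1 u hu k huk]
        · exact absurd ⟨(⟨u, hu⟩, k), by simpa using huk, rfl⟩ hne
      · intro p _
        rfl
    rw [← h1, Finset.sum_filter, ← Finset.univ_product_univ, Finset.sum_product]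
    refine Finset.sum_eq_zero fun u _ => ?_
    refine Eq.trans ?_ (H2 u u.2 (fun k => w ⟨dualEdge u k, hA.dualEdge_mem u.2 k⟩) fun k hk hk' =>
      hw _ _ (hA.meetAtTwoValent_iff.2 ⟨u, u.2, k, hk, hk', Or.inl rfl, Or.inr rfl⟩))
    refine Finset.sum_congr rfl fun k _ => ?_
    by_cases huk : (u : ℤ × ℤ) + dir k ∈ I <;> simp [huk]

/-! ### The kernel -/

-- Let v be w, set to zero on p. The coefficient of x k is v (k + 1) + v (k - 1) - v k. If k and
-- just one cyclic neighbour are outside p, it cancels; if both neighbours are outside as well, w k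
-- remains. Both neighbours in p would put k in p by `hp`, where x vanishes.
open Classical in
lemma sum_hexagon (p : Fin 6 → Prop) (x w : Fin 6 → ℝ) (hx : ∀ k, p k → x k = 0)
    (hp : ∀ k, p (k - 1) → p (k + 1) → p k)
    (hw : ∀ k, ¬ p k → ¬ p (k + 1) → w k = w (k + 1)) :
    ∑ k, (if p k then 0 else w k * (x (k - 1) + x (k + 1) - x k)) =
      ∑ k, (if p (k - 1) ∨ p k ∨ p (k + 1) then 0 else w k * x k) := by
  set v : Fin 6 → ℝ := fun k => if p k then 0 else w k with hv
  have e1 : ∑ k, v k * x (k - 1) = ∑ k, v (k + 1) * x k := by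
    rw [← Equiv.sum_comp (Equiv.addRight (1 : Fin 6))]
    simp
  have e2 : ∑ k, v k * x (k + 1) = ∑ k, v (k - 1) * x k := by
    rw [← Equiv.sum_comp (Equiv.subRight (1 : Fin 6))]
    simp
  have e3 : ∑ k, (if p k then 0 else w k * (x (k - 1) + x (k + 1) - x k)) =
      ∑ k, (v (k + 1) + v (k - 1) - v k) * x k := by
    simp only [sub_mul, add_mul, Finset.sum_add_distrib, Finset.sum_sub_distrib]
    rw [← e1, ← e2, ← Finset.sum_add_distrib, ← Finset.sum_sub_distrib]
    refine Finset.sum_congr rfl fun k _ => ?_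
    simp only [hv]
    split_ifs <;> ring
  rw [e3]
  refine Finset.sum_congr rfl fun k _ => ?_
  simp only [hv]
  have h1 := hp k
  have h2 := hw k
  have h3 := hw (k - 1)
  rw [sub_add_cancel] at h3
  by_cases c1 : p k
  · simp [c1, hx k c1]
  · by_cases c2 : p (k - 1) <;> by_cases c3 : p (k + 1)
    · exact absurd (h1 c2 c3) c1
    · simp [c1, c2, c3, h2]
    · simp [c1, c2, c3, h3]
    · simp [c1, c2, c3, h3, ← h2]

/-- Two arcs of three positions in a cycle of six overlap or fill the cycle, so both belong to the
same run. -/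
lemma eq_of_triples (p : Fin 6 → Prop) (w : Fin 6 → ℝ)
    (hw : ∀ k, ¬ p k → ¬ p (k + 1) → w k = w (k + 1)) (j k : Fin 6)
    (hj : ¬ (p (j - 1) ∨ p j ∨ p (j + 1))) (hk : ¬ (p (k - 1) ∨ p k ∨ p (k + 1))) :
    w j = w k := by
  obtain ⟨d, rfl⟩ : ∃ d, k = j + d := ⟨k - j, by abel⟩
  have h0 := hw j
  have h1 := hw (j + 1)
  have h2 := hw (j + 2)
  have h3 := hw (j + 3)
  have h4 := hw (j + 4)
  have h5 := hw (j + 5)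
  simp only [add_assoc, add_sub_assoc] at hk h0 h1 h2 h3 h4 h5
  rw [show j - 1 = j + 5 by clear * -; revert j; decide] at hj
  fin_cases d <;> simp [show (1 + 1 : Fin 6) = 2 from rfl, show (2 + 1 : Fin 6) = 3 from rfl,
    show (3 + 1 : Fin 6) = 4 from rfl, show (4 + 1 : Fin 6) = 5 from rfl,
    show (5 + 1 : Fin 6) = 0 from rfl, show (2 - 1 : Fin 6) = 1 from rfl,
    show (3 - 1 : Fin 6) = 2 from rfl, show (4 - 1 : Fin 6) = 3 from rfl,
    show (5 - 1 : Fin 6) = 4 from rfl] at * <;> grind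

open Classical in
/-- The sum of the heights at those neighbours of `u` that, together with the two neighbours of `u`
next to them, do not belong to `I`. -/
noncomputable def cornerSum (I : Set (ℤ × ℤ)) (u : ℤ × ℤ) : (ℤ × ℤ → ℝ) →ₗ[ℝ] ℝ :=
  ∑ k, if u + dir (k - 1) ∈ I ∨ u + dir k ∈ I ∨ u + dir (k + 1) ∈ I then 0
    else LinearMap.proj (u + dir k)

open Classical in
lemma cornerSum_apply (I : Set (ℤ × ℤ)) (u : ℤ × ℤ) (h : ℤ × ℤ → ℝ) :
    cornerSum I u h = ∑ k, if u + dir (k - 1) ∈ I ∨ u + dir k ∈ I ∨ u + dir (k + 1) ∈ I then 0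
      else h (u + dir k) := by
  rw [cornerSum, LinearMap.sum_apply]
  refine Finset.sum_congr rfl fun k _ => ?_
  split_ifs <;> simp

/-- By `sum_hexagon` only the middles of outside triples survive in the sums around u, and by
`eq_of_triples` they all carry the same weight. So each u imposes just one equation. -/
lemma IsInner.skeletonMap_eq_zero_iff_of_eq_zero (hA : IsInner A I)
    [Finite (coreGraph (dualGraph (unitTriangulation A))).edgeSet] (h : ℤ × ℤ → ℝ)
    (h0 : ∀ u ∈ I, h u = 0) :
    skeletonMap A h = 0 ↔
      (∀ u ∈ I, ∀ k, u + dir k ∈ I → h (u + dir (k - 1)) + h (u + dir (k + 1)) = 0) ∧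
      ∀ u ∈ I, cornerSum I u h = 0 := by
  classical
  rw [hA.skeletonMap_eq_zero_iff]
  have key : ∀ u ∈ I, ∀ w : Fin 6 → ℝ,
        (∀ k, u + dir k ∉ I → u + dir (k + 1) ∉ I → w k = w (k + 1)) →
        ∑ k, (if u + dir k ∈ I then 0 else w k * bend h (dualEdge u k)) =
        ∑ k, (if u + dir (k - 1) ∈ I ∨ u + dir k ∈ I ∨ u + dir (k + 1) ∈ I then 0 else
          w k * h (u + dir k)) := by
    intro u hu w hw
    rw [← sum_hexagon (fun k => u + dir k ∈ I) (fun k => h (u + dir k)) w (fun k => h0 _) ?_ hw]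
    · simp only [bend_dualEdge, h0 u hu, sub_zero]
    · intro k h1 h2
      have := hA.hex.short_diagonal h1 (k := k - 1)
        (by rwa [show k - 1 + 2 = k + 1 by clear * -; revert k; decide])
      rw [sub_add_cancel] at this
      exact this.2
  refine and_congr ?_ ?_
  · refine forall₂_congr fun u hu => forall₂_congr fun k hk => ?_
    rw [bend_dualEdge, h0 u hu, h0 _ hk, sub_zero, sub_zero]
  · refine forall₂_congr fun u hu => ?_
    constructor
    · intro H
      have := H (fun _ => 1) (fun _ _ _ => rfl)
      rw [key u hu _ (fun _ _ _ => rfl)] at this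
      rw [cornerSum_apply]
      simpa using this
    · intro H w hw
      rw [key u hu w hw]
      by_cases hk : ∃ k, ¬ (u + dir (k - 1) ∈ I ∨ u + dir k ∈ I ∨ u + dir (k + 1) ∈ I)
      · obtain ⟨k, hk⟩ := hk
        rw [cornerSum_apply] at H
        refine Eq.trans ?_ (mul_eq_zero_of_right (w k) H)
        rw [Finset.mul_sum]
        refine Finset.sum_congr rfl fun j _ => ?_
        split_ifs with hj
        · simp
        · rw [eq_of_triples (fun k => u + dir k ∈ I) w hw j k hj hk]
      · push Not at hk
        exact Finset.sum_eq_zero fun k _ => if_pos (hk k)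

/-- The affine function with coefficients `c`. -/
def affineFun (c : ℝ × ℝ × ℝ) (z : ℤ × ℤ) : ℝ := c.1 + c.2.1 * z.1 + c.2.2 * z.2

lemma affineFun_add_dir (c : ℝ × ℝ × ℝ) (u : ℤ × ℤ) (k : Fin 6) :
    affineFun c (u + dir (k - 1)) + affineFun c (u + dir (k + 1)) =
      affineFun c u + affineFun c (u + dir k) := by
  have h := dir_sub_one k
  have h1 := congrArg Prod.fst h
  have h2 := congrArg Prod.snd h
  simp only [Prod.fst_sub, Prod.snd_sub] at h1 h2
  simp only [affineFun, Prod.fst_add, Prod.snd_add, h1, h2]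
  push_cast
  ring

lemma bend_affineFun (c : ℝ × ℝ × ℝ) (u : ℤ × ℤ) (k : Fin 6) :
    bend (affineFun c) (dualEdge u k) = 0 := by
  rw [bend_dualEdge]
  linarith [affineFun_add_dir c u k]

lemma IsInner.skeletonMap_affineFun (hA : IsInner A I)
    [Finite (coreGraph (dualGraph (unitTriangulation A))).edgeSet] (c : ℝ × ℝ × ℝ) :
    skeletonMap A (affineFun c) = 0 := by
  rw [hA.skeletonMap_eq_zero_iff]
  simp [bend_affineFun]

/-- On one side of a segment the edges in directions j + 1 and j + 2 form a run whose bends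
telescope. The weight is the indicator of this run. For a segment, this replaces the rhombus
relations. -/
lemma IsInner.second_difference (hA : IsInner A I)
    [Finite (coreGraph (dualGraph (unitTriangulation A))).edgeSet] {h : ℤ × ℤ → ℝ}
    (hh : skeletonMap A h = 0) {u : ℤ × ℤ} {j : Fin 6} (hu : u ∈ I) (h0 : u + dir j ∈ I)
    (h1 : u + dir (j + 1) ∉ I) (h2 : u + dir (j + 2) ∉ I) (h3 : u + dir (j + 3) ∈ I) :
    h (u + dir j) + h (u + dir (j + 3)) = 2 * h u := by
  classical
  have := ((hA.skeletonMap_eq_zero_iff h).1 hh).2 u hu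
    (fun k => if k = j + 1 ∨ k = j + 2 then 1 else 0) fun k hk hk' => by
      have c0 : k ≠ j := fun h => hk (h ▸ h0)
      have c1 : k ≠ j + 2 := fun h => hk' (by rwa [h, add_assoc j 2 1])
      have : (k = j + 1 ∨ k = j + 2) ↔ (k + 1 = j + 1 ∨ k + 1 = j + 2) := by
        clear * - c0 c1; revert j k; decide
      simp only [this]
  rw [← Finset.sum_subset (Finset.subset_univ {j + 1, j + 2}), Finset.sum_pair] at this
  · simp only [h1, h2, bend_dualEdge, if_false, true_or, or_true, if_true, one_mul,
      add_sub_cancel_right, add_assoc, show (1 + 1 : Fin 6) = 2 from rfl, add_sub_assoc,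
      show (2 + 1 : Fin 6) = 3 from rfl, show (2 - 1 : Fin 6) = 1 from rfl] at this
    linarith
  · simp
  · intro k _ hk
    simp only [Finset.mem_insert, Finset.mem_singleton] at hk
    simp [hk]

/-! ### Boundary points, corners and boundary edges of a hexagonal set -/

lemma dir_add_four (k : Fin 6) : dir (k + 4) = -dir (k + 1) := by
  revert k; decide

lemma dir_add_five (k : Fin 6) : dir (k + 5) = dir k - dir (k + 1) := by
  revert k; decide

lemma frame_inj {k : Fin 6} {x y x' y' : ℤ}
    (h : x • dir k + y • dir (k + 1) = x' • dir k + y' • dir (k + 1)) : x = x' ∧ y = y' := by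
  have h1 := congrArg Prod.fst h
  have h2 := congrArg Prod.snd h
  clear h
  fin_cases k <;> simp [dir, show (5 + 1 : Fin 6) = 0 from rfl] at h1 h2 <;> omega

/-- The points of `I` with a neighbour outside `I`. -/
def boundaryPoints (I : Set (ℤ × ℤ)) : Set (ℤ × ℤ) := {u | u ∈ I ∧ ∃ k, u + dir k ∉ I}

/-- The points of `I` with three consecutive neighbours outside `I`. -/
def cornerPoints (I : Set (ℤ × ℤ)) : Set (ℤ × ℤ) :=
  {u | u ∈ I ∧ ∃ k, u + dir (k - 1) ∉ I ∧ u + dir k ∉ I ∧ u + dir (k + 1) ∉ I}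

/-- The oriented edges of `I` that have a point outside `I` next to them on the left. -/
def boundaryEdges (I : Set (ℤ × ℤ)) : Set ((ℤ × ℤ) × Fin 6) :=
  {p | p.1 ∈ I ∧ p.1 + dir p.2 ∈ I ∧ p.1 + dir (p.2 + 1) ∉ I}

/-- Directions two or three steps apart would put q into I, as an end of a short diagonal or as a
midpoint. -/
lemma IsHexagonal.neighbors_of_notMem (hI : IsHexagonal I) {q : ℤ × ℤ} (hq : q ∉ I)
    {i j : Fin 6} (hi : q + dir i ∈ I) (hj : q + dir j ∈ I) : j = i ∨ j = i + 1 ∨ i = j + 1 := by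
  have h1 : j ≠ i + 2 := by
    rintro rfl
    exact hq (hI.short_diagonal hi hj).1
  have h2 : i ≠ j + 2 := by
    rintro rfl
    exact hq (hI.short_diagonal hj hi).1
  have h3 : j ≠ i + 3 := by
    rintro rfl
    exact hq (hI.midpoint hi hj)
  clear * - h1 h2 h3; revert i j; decide

lemma add_dir_add_dir_add_three (u : ℤ × ℤ) (k : Fin 6) : u + dir k + dir (k + 3) = u := by
  rw [dir_add_three]; abel

/-- Seen from u + dir k, a second neighbour in I would have to be cyclically adjacent to u, hence
one of u + dir (k - 1) and u + dir (k + 1), which are outside I. So the middle of an outside triple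
belongs to one corner only. -/
lemma IsHexagonal.corner_unique (hI : IsHexagonal I) {u v : ℤ × ℤ} {k l : Fin 6} (hu : u ∈ I)
    (h1 : u + dir (k - 1) ∉ I) (h2 : u + dir k ∉ I) (h3 : u + dir (k + 1) ∉ I) (hv : v ∈ I)
    (h : v + dir l = u + dir k) : v = u ∧ l = k := by
  have e1 := add_dir_add_dir_add_three u k
  have e2 := add_dir_add_dir_add_three v l
  rw [h] at e2
  have e3 : u + dir k + dir (k + 3 + 1) = u + dir (k - 1) := by
    rw [add_assoc k, show (3 + 1 : Fin 6) = 4 from rfl, dir_add_four, dir_sub_one]; abel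
  have e4 : u + dir k + dir (k + 2) = u + dir (k + 1) := by rw [add_assoc, dir_add_two]
  rcases hI.neighbors_of_notMem h2 (e1.symm ▸ hu) (e2.symm ▸ hv) with h' | h' | h'
  · have := add_right_cancel h'
    subst this
    exact ⟨add_right_cancel h, rfl⟩
  · rw [h', e3] at e2
    exact absurd (e2 ▸ hv) h1
  · have : l + 3 = k + 2 := by clear * - h'; revert k l; decide
    rw [this, e4] at e2
    exact absurd (e2 ▸ hv) h3

lemma IsHexagonal.boundaryEdges_inj (hI : IsHexagonal I) {p q : (ℤ × ℤ) × Fin 6}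
    (hp : p ∈ boundaryEdges I) (hq : q ∈ boundaryEdges I)
    (h : p.1 + dir (p.2 + 1) = q.1 + dir (q.2 + 1)) : p = q := by
  obtain ⟨u, j⟩ := p
  obtain ⟨v, l⟩ := q
  obtain ⟨hp1, hp2, hp3⟩ := hp
  obtain ⟨hq1, hq2, hq3⟩ := hq
  dsimp only at *
  have e : ∀ u j, u + dir (j + 1) + dir (j + 4) = u := fun u j => by rw [dir_add_four]; abel
  have e' : ∀ u j, u + dir (j + 1) + dir (j + 5) = u + dir j := fun u j => by
    rw [dir_add_five]; abel
  have a1 := e u j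
  have a2 := e' u j
  have b1 := e v l
  have b2 := e' v l
  rw [← h] at b1 b2
  rw [← a1] at hp1
  rw [← a2] at hp2
  rw [← b1] at hq1
  rw [← b2] at hq2
  have c1 := hI.neighbors_of_notMem hp3 hp1 hq2
  have c2 := hI.neighbors_of_notMem hp3 hp2 hq1
  have : j = l := by clear * - c1 c2; revert j l; decide
  subst this
  rw [add_right_cancel h]

/-- A hexagonal set with at least two points contains a triangle or consists of the lattice points
of a segment. -/
lemma IsHexagonal.triangle_or_segment (hI : IsHexagonal I) (hfin : I.Finite)
    (h2 : 2 ≤ I.ncard) :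
    (∃ u k, u ∈ I ∧ u + dir k ∈ I ∧ u + dir (k + 1) ∈ I) ∨
      ∃ (p : ℤ × ℤ) (j : Fin 6) (n : ℕ), 1 ≤ n ∧
        ∀ x y : ℤ, p + x • dir j + y • dir (j + 1) ∈ I ↔ y = 0 ∧ 0 ≤ x ∧ x ≤ n := by
  refine or_iff_not_imp_left.2 fun hT => ?_
  obtain ⟨u, hu, z, hz, hne⟩ := (Set.one_lt_ncard hfin).1 h2
  obtain ⟨j, hj⟩ := hI.exists_neighbor hu hz hne.symm
  have hline : ∀ z ∈ I, ∃ i : ℤ, z = u + i • dir j := by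
    intro z hz
    rcases hI.on_line hu hj hz with h | h | h
    · exact absurd ⟨u, j, hu, hj, h⟩ hT
    · exact absurd ⟨u, j - 1, hu, h, by rwa [sub_add_cancel]⟩ hT
    · exact h
  have hinj : Function.Injective fun i : ℤ => u + i • dir j := fun i i' h => by
    refine (frame_inj (k := j) (y := 0) (y' := 0) ?_).1
    simpa using h
  have hJ : (((fun i : ℤ => u + i • dir j) ⁻¹' I)).Finite := hfin.preimage hinj.injOn
  set J := hJ.toFinset with hJdef
  have hmem : ∀ i, i ∈ J ↔ u + i • dir j ∈ I := fun i => by simp [hJdef]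
  have h0 : (0 : ℤ) ∈ J := (hmem 0).2 (by simpa using hu)
  have h1 : (1 : ℤ) ∈ J := (hmem 1).2 (by simpa using hj)
  set m := J.min' ⟨0, h0⟩
  set M := J.max' ⟨0, h0⟩
  have hm : u + m • dir j ∈ I := (hmem m).1 (J.min'_mem _)
  have hM : u + M • dir j ∈ I := (hmem M).1 (J.max'_mem _)
  have hm0 : m ≤ 0 := J.min'_le _ h0
  have hM1 : 1 ≤ M := J.le_max' _ h1
  refine ⟨u + m • dir j, j, (M - m).toNat, by omega, fun x y => ?_⟩
  constructor
  · intro h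
    obtain ⟨i, hi⟩ := hline _ h
    have := frame_inj (k := j) (x := m + x) (y := y) (x' := i) (y' := 0) (by
      have : u + ((m + x) • dir j + y • dir (j + 1)) = u + (i • dir j + (0 : ℤ) • dir (j + 1)) := by
        rw [zero_smul, add_zero, ← hi]; module
      exact add_left_cancel this)
    have hiJ : i ∈ J := (hmem i).2 (hi ▸ h)
    have b1 : m ≤ i := J.min'_le _ hiJ
    have b2 : i ≤ M := J.le_max' _ hiJ
    omega
  · rintro ⟨rfl, hx0, hx1⟩
    have := hI.line_ordConnected hm hM (l := m + x) (by omega) (by omega)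
    rwa [show u + m • dir j + x • dir j + (0 : ℤ) • dir (j + 1) = u + (m + x) • dir j by module]

lemma IsHexagonal.side_of_triangle (hI : IsHexagonal I) {v : ℤ × ℤ} {k : Fin 6} (hv : v ∈ I)
    (hv1 : v + dir k ∈ I) (hv2 : v + dir (k + 1) ∈ I) {u : ℤ × ℤ} {j : Fin 6} (hu : u ∈ I)
    (huj : u + dir j ∈ I) : u + dir (j + 1) ∈ I ∨ u + dir (j - 1) ∈ I := by
  by_contra! hc
  have key : ∀ z ∈ I, ∃ i : ℤ, z = u + i • dir j := fun z hz => by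
    rcases hI.on_line hu huj hz with h | h | h
    · exact absurd h hc.1
    · exact absurd h hc.2
    · exact h
  obtain ⟨a, ha⟩ := key _ hv
  obtain ⟨b, hb⟩ := key _ hv1
  obtain ⟨c, hc'⟩ := key _ hv2
  have hb' : dir k = (b - a) • dir j := by
    rw [sub_smul, ← add_right_inj v, hb, ha]; abel
  have hc'' : dir (k + 1) = (c - a) • dir j := by
    rw [sub_smul, ← add_right_inj v, hc', ha]; abel
  have := frame_inj (k := k) (x := c - a) (y := 0) (x' := 0) (y' := b - a) (by
    rw [hb', hc'']; module)
  refine dir_ne_zero k ?_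
  rw [hb', ← this.2, zero_smul]

lemma IsHexagonal.ncard_boundaryEdges (hI : IsHexagonal I) {v : ℤ × ℤ} {k : Fin 6} (hv : v ∈ I)
    (hv1 : v + dir k ∈ I) (hv2 : v + dir (k + 1) ∈ I) :
    (boundaryEdges I).ncard = (boundaryPoints I).ncard := by
  have himg : Prod.fst '' boundaryEdges I = boundaryPoints I := by
    ext u
    constructor
    · rintro ⟨⟨u, j⟩, ⟨h1, h2, h3⟩, rfl⟩
      exact ⟨h1, _, h3⟩
    · rintro ⟨hu, l, hl⟩
      obtain ⟨j, hj⟩ : ∃ j, u + dir j ∈ I := by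
        by_cases huv : v = u
        · exact ⟨k, huv ▸ hv1⟩
        · exact hI.exists_neighbor hu hv huv
      -- If no boundary edge started at u, membership in I would propagate around u to all six
      -- neighbours.
      by_contra hc
      have step : ∀ i, u + dir i ∈ I → u + dir (i + 1) ∈ I := by
        intro i hi
        by_contra hi'
        exact hc ⟨(u, i), ⟨hu, hi, hi'⟩, rfl⟩
      have s1 := step _ hj
      have s2 := step _ s1
      have s3 := step _ s2
      have s4 := step _ s3
      have s5 := step _ s4
      simp only [add_assoc j] at s2 s3 s4 s5
      have all : ∀ d : Fin 6, u + dir (j + d) ∈ I := by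
        intro d
        fin_cases d
        exacts [by simpa using hj, s1, s2, s3, s4, s5]
      have := all (l - j)
      rw [add_sub_cancel] at this
      exact hl this
  rw [← himg]
  refine (Set.InjOn.ncard_image ?_).symm
  rintro ⟨u, j⟩ ⟨h1, h2, h3⟩ ⟨u', j'⟩ ⟨h1', h2', h3'⟩ heq
  dsimp only at *
  subst heq
  have d1 : j' ≠ j + 1 := by rintro rfl; exact h3 h2'
  have d5 : j ≠ j' + 1 := by rintro rfl; exact h3' h2
  have d2 : j' ≠ j + 2 := by rintro rfl; exact h3 (hI.short_diagonal h2 h2').2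
  have d4 : j ≠ j' + 2 := by rintro rfl; exact h3' (hI.short_diagonal h2' h2).2
  -- This is where the triangle matters: in a segment, two opposite boundary edges start at every
  -- inner point.
  have d3 : j' ≠ j + 3 := by
    rintro rfl
    rcases hI.side_of_triangle hv hv1 hv2 h1 h2 with h | h
    · exact h3 h
    · refine h3' (hI.short_diagonal h2' ?_).2
      rwa [show j + 3 + 2 = j - 1 by clear * -; revert j; decide]
  have : j = j' := by clear * - d1 d2 d3 d4 d5; revert j j'; decide
  rw [this]

/-! ### The rank of the length map -/

/-- L factors through M, and the kernel of the induced map on W is the injective image of U. -/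
lemma finrank_range_add_finrank {F G W U : Type*} [AddCommGroup F] [Module ℝ F] [AddCommGroup G]
    [Module ℝ G] [AddCommGroup W] [Module ℝ W] [FiniteDimensional ℝ W] [AddCommGroup U]
    [Module ℝ U] [FiniteDimensional ℝ U] (L : F →ₗ[ℝ] G) (M : F →ₗ[ℝ] W) (a : U →ₗ[ℝ] F)
    (hM : Function.Surjective M) (hML : ∀ h, M h = 0 → L h = 0) (ha : ∀ u, L (a u) = 0)
    (hinj : ∀ u, M (a u) = 0 → u = 0) (hL : ∀ h, L h = 0 → ∃ u, M h = M (a u)) :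
    Module.finrank ℝ (LinearMap.range L) + Module.finrank ℝ U = Module.finrank ℝ W := by
  obtain ⟨s, hs⟩ := M.exists_rightInverse_of_surjective (LinearMap.range_eq_top.2 hM)
  have hs' : ∀ w, M (s w) = w := fun w => LinearMap.congr_fun hs w
  have hL' : ∀ h, L (s (M h)) = L h := fun h => by
    rw [← sub_eq_zero, ← map_sub]
    exact hML _ (by rw [map_sub, hs', sub_self])
  have h1 : LinearMap.range (L.comp s) = LinearMap.range L := by
    ext g
    constructor
    · rintro ⟨w, rfl⟩
      exact ⟨s w, rfl⟩
    · rintro ⟨h, rfl⟩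
      exact ⟨M h, hL' h⟩
  have h2 : LinearMap.ker (L.comp s) = LinearMap.range (M.comp a) := by
    ext w
    constructor
    · intro hw
      obtain ⟨u, hu⟩ := hL (s w) hw
      exact ⟨u, by rw [LinearMap.comp_apply, ← hu, hs']⟩
    · rintro ⟨u, rfl⟩
      rw [LinearMap.mem_ker, LinearMap.comp_apply, LinearMap.comp_apply, hL', ha]
  have h3 : Function.Injective (M.comp a) :=
    (injective_iff_map_eq_zero _).2 fun u hu => hinj u hu
  rw [← LinearMap.finrank_range_add_finrank_ker (L.comp s), h1, h2,
    LinearMap.finrank_range_of_inj h3]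

open Classical in
/-- The sum of the heights at those points outside `I` that form a triangle with the given edge. -/
noncomputable def outerSum (I : Set (ℤ × ℤ)) (p : (ℤ × ℤ) × Fin 6) : (ℤ × ℤ → ℝ) →ₗ[ℝ] ℝ :=
  (LinearMap.proj (p.1 + dir (p.2 + 1)) : (ℤ × ℤ → ℝ) →ₗ[ℝ] ℝ) +
    if p.1 + dir (p.2 - 1) ∈ I then 0 else LinearMap.proj (p.1 + dir (p.2 - 1))

lemma outerSum_apply (I : Set (ℤ × ℤ)) (p : (ℤ × ℤ) × Fin 6) (h : ℤ × ℤ → ℝ)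
    (h0 : ∀ z ∈ I, h z = 0) :
    outerSum I p h = h (p.1 + dir (p.2 + 1)) + h (p.1 + dir (p.2 - 1)) := by
  rw [outerSum]
  split_ifs with hp
  · simp [h0 _ hp]
  · simp

lemma reverse_left (u : ℤ × ℤ) (j : Fin 6) :
    u + dir j + dir (j + 3 + 1) = u + dir (j - 1) := by
  rw [add_assoc j, show (3 + 1 : Fin 6) = 4 from rfl, dir_add_four, dir_sub_one]; abel

lemma reverse_right (u : ℤ × ℤ) (j : Fin 6) :
    u + dir j + dir (j + 3 - 1) = u + dir (j + 1) := by
  rw [add_sub_assoc, show (3 - 1 : Fin 6) = 2 from rfl, add_assoc, dir_add_two]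

/-- The coordinates for height functions modulo the kernel of the length map. -/
noncomputable def heightCoordinates (I : Set (ℤ × ℤ)) (Y : Set ((ℤ × ℤ) × Fin 6)) :
    (ℤ × ℤ → ℝ) →ₗ[ℝ] (I ⊕ Y ⊕ cornerPoints I → ℝ) :=
  LinearMap.pi (Sum.elim (fun u => LinearMap.proj (u : ℤ × ℤ))
    (Sum.elim (fun p => outerSum I p) fun u => cornerSum I u))

lemma IsHexagonal.heightCoordinates_surjective (hI : IsHexagonal I)
    {Y : Set ((ℤ × ℤ) × Fin 6)} (hY : Y ⊆ boundaryEdges I)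
    (hY1 : ∀ p ∈ Y, (p.1 + dir p.2, p.2 + 3) ∉ Y) :
    Function.Surjective (heightCoordinates I Y) := by
  classical
  have hk : ∀ u : cornerPoints I, ∃ k, (u : ℤ × ℤ) + dir (k - 1) ∉ I ∧
      (u : ℤ × ℤ) + dir k ∉ I ∧ (u : ℤ × ℤ) + dir (k + 1) ∉ I := fun u => u.2.2
  choose κ hκ using hk
  -- Each coordinate gets a lattice point of its own: the point of I, the apex over the boundary
  -- edge, or the middle of an outside triple at the corner. On heights supported at these points
  -- the coordinates are diagonal.
  set pt : I ⊕ Y ⊕ cornerPoints I → ℤ × ℤ := Sum.elim (fun u => u)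
    (Sum.elim (fun p => p.1.1 + dir (p.1.2 + 1)) fun u => u + dir (κ u)) with hpt
  -- An apex has two neighbours in I, the middle of an outside triple only one.
  have hne : ∀ (u : ℤ × ℤ) (k : Fin 6) (p : (ℤ × ℤ) × Fin 6), u ∈ I → p ∈ boundaryEdges I →
      u + dir (k - 1) ∉ I → u + dir k ∉ I → u + dir (k + 1) ∉ I →
      p.1 + dir (p.2 + 1) ≠ u + dir k := by
    rintro u k ⟨v, j⟩ hu ⟨h1, h2, h3⟩ k1 k2 k3 heq
    obtain ⟨rfl, rfl⟩ := hI.corner_unique hu k1 k2 k3 h1 heq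
    have := (hI.corner_unique hu k1 k2 k3 (v := v + dir j) (l := j + 2) h2
      (by rw [add_assoc, dir_add_two])).1
    exact add_dir_ne _ _ this
  have hinj : Function.Injective pt := by
    rintro (u | p | u) (v | q | v) h
    · simpa [hpt, Subtype.ext_iff] using h
    · exact absurd (h ▸ u.2 : pt (Sum.inr (Sum.inl q)) ∈ I) (hY q.2).2.2
    · exact absurd (h ▸ u.2 : pt (Sum.inr (Sum.inr v)) ∈ I) (hκ v).2.1
    · exact absurd (h ▸ v.2 : pt (Sum.inr (Sum.inl p)) ∈ I) (hY p.2).2.2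
    · rw [Subtype.ext (hI.boundaryEdges_inj (hY p.2) (hY q.2) h)]
    · exact absurd h (hne v (κ v) p v.2.1 (hY p.2) (hκ v).1 (hκ v).2.1 (hκ v).2.2)
    · exact absurd (h ▸ v.2 : pt (Sum.inr (Sum.inr u)) ∈ I) (hκ u).2.1
    · exact absurd h.symm (hne u (κ u) q u.2.1 (hY q.2) (hκ u).1 (hκ u).2.1 (hκ u).2.2)
    · rw [Subtype.ext (hI.corner_unique v.2.1 (hκ v).1 (hκ v).2.1 (hκ v).2.2 u.2.1 h).1]
  intro c
  refine ⟨Function.extend pt c 0, ?_⟩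
  have happ : ∀ x, Function.extend pt c 0 (pt x) = c x := fun x => hinj.extend_apply _ _ _
  have hout : ∀ z, (∀ x, pt x ≠ z) → Function.extend pt c 0 z = 0 := fun z hz => by
    rw [Function.extend_apply' _ _ _ (fun ⟨x, hx⟩ => hz x hx)]; rfl
  ext x
  rcases x with u | p | u
  · exact happ (Sum.inl u)
  · change outerSum I p _ = _
    have h1 := happ (Sum.inr (Sum.inl p))
    rw [outerSum]
    split_ifs with hp
    · rw [add_zero]; exact h1
    · rw [LinearMap.add_apply, LinearMap.proj_apply, LinearMap.proj_apply]
      refine (congrArg₂ _ h1 (hout _ ?_)).trans (add_zero _)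
      -- If both sides of the edge are outside I, the second point is the apex of the reversed edge.
      -- That edge is not in Y by `hY1`, so the height there is 0.
      have hrev : ((p : (ℤ × ℤ) × Fin 6).1 + dir p.1.2, p.1.2 + 3) ∈ boundaryEdges I := by
        refine ⟨(hY p.2).2.1, ?_, ?_⟩
        · rw [add_dir_add_dir_add_three]; exact (hY p.2).1
        · rwa [reverse_left]
      rintro (v | q | v) hx
      · exact hp (hx ▸ v.2)
      · have := hI.boundaryEdges_inj (hY q.2) hrev (by rw [reverse_left]; exact hx)
        exact hY1 p p.2 (this ▸ q.2)
      · refine hne v (κ v) _ v.2.1 hrev (hκ v).1 (hκ v).2.1 (hκ v).2.2 ?_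
        rw [reverse_left]; exact hx.symm
  · change cornerSum I u _ = _
    rw [cornerSum_apply, Finset.sum_eq_single (κ u)]
    · have := hκ u
      rw [if_neg (by tauto)]
      exact happ (Sum.inr (Sum.inr u))
    · intro k _ hk
      split_ifs with h
      · rfl
      · push Not at h
        refine hout _ ?_
        rintro (v | q | v) hx
        · exact h.2.1 (hx ▸ v.2)
        · exact hne u k q u.2.1 (hY q.2) h.1 h.2.1 h.2.2 hx
        · have := hI.corner_unique u.2.1 h.1 h.2.1 h.2.2 v.2.1 hx
          rw [Subtype.ext this.1] at this
          exact hk this.2.symm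
    · simp

lemma IsInner.heightCoordinates_eq_zero (hA : IsInner A I)
    [Finite (coreGraph (dualGraph (unitTriangulation A))).edgeSet]
    {Y : Set ((ℤ × ℤ) × Fin 6)}
    (hY2 : ∀ p ∈ boundaryEdges I, p ∈ Y ∨ (p.1 + dir p.2, p.2 + 3) ∈ Y) {h : ℤ × ℤ → ℝ}
    (hh : heightCoordinates I Y h = 0) : skeletonMap A h = 0 := by
  have h0 : ∀ u ∈ I, h u = 0 := fun u hu => congrFun hh (Sum.inl ⟨u, hu⟩)
  have h1 : ∀ p ∈ Y, h (p.1 + dir (p.2 + 1)) + h (p.1 + dir (p.2 - 1)) = 0 := fun p hp => by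
    rw [← outerSum_apply I p h h0]
    exact congrFun hh (Sum.inr (Sum.inl ⟨p, hp⟩))
  have h2 : ∀ u ∈ cornerPoints I, cornerSum I u h = 0 := fun u hu =>
    congrFun hh (Sum.inr (Sum.inr ⟨u, hu⟩))
  have key : ∀ u k, (u, k) ∈ boundaryEdges I →
      h (u + dir (k - 1)) + h (u + dir (k + 1)) = 0 := by
    intro u k huk
    rcases hY2 _ huk with h' | h'
    · rw [add_comm]
      exact h1 _ h'
    · have := h1 _ h'
      dsimp only at this
      rwa [reverse_left, reverse_right] at this
  rw [hA.skeletonMap_eq_zero_iff_of_eq_zero h h0]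
  refine ⟨fun u hu k huk => ?_, fun u hu => ?_⟩
  · by_cases c1 : u + dir (k + 1) ∈ I
    · by_cases c2 : u + dir (k - 1) ∈ I
      · rw [h0 _ c1, h0 _ c2, add_zero]
      · have := key (u + dir k) (k + 3) ⟨huk, by rwa [add_dir_add_dir_add_three],
          by rwa [reverse_left]⟩
        rwa [reverse_left, reverse_right, add_comm] at this
    · exact key u k ⟨hu, huk, c1⟩
  · by_cases huc : u ∈ cornerPoints I
    · exact h2 u huc
    · rw [cornerSum_apply]
      refine Finset.sum_eq_zero fun k _ => if_pos ?_
      by_contra! hc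
      exact huc ⟨hu, k, hc⟩

/-- Y contains one orientation of each boundary edge, so an edge with both sides outside I is
counted once. Together with the parameter space U for the affine functions on I, this treats the
triangle and the segment case at once. -/
lemma IsInner.finrank_range (hA : IsInner A I)
    [Finite (coreGraph (dualGraph (unitTriangulation A))).edgeSet]
    {Y : Set ((ℤ × ℤ) × Fin 6)} (hY : Y ⊆ boundaryEdges I)
    (hY1 : ∀ p ∈ Y, (p.1 + dir p.2, p.2 + 3) ∉ Y)
    (hY2 : ∀ p ∈ boundaryEdges I, p ∈ Y ∨ (p.1 + dir p.2, p.2 + 3) ∈ Y)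
    {U : Type} [AddCommGroup U] [Module ℝ U] [FiniteDimensional ℝ U]
    (a : U →ₗ[ℝ] (ℤ × ℤ → ℝ)) (ha : ∀ u, ∃ c, a u = affineFun c)
    (hinj : ∀ u, (∀ z ∈ I, a u z = 0) → u = 0)
    (hker : ∀ h, skeletonMap A h = 0 → ∃ u, ∀ z ∈ I, h z = a u z) :
    Module.finrank ℝ (LinearMap.range (skeletonMap A)) + Module.finrank ℝ U =
      I.ncard + Y.ncard + (cornerPoints I).ncard := by
  have hIf : I.Finite := hA.finite.subset hA.subset
  have hYf : Y.Finite := (hIf.prod (Set.finite_univ (α := Fin 6))).subset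
    fun p hp => ⟨(hY hp).1, trivial⟩
  have hVf : (cornerPoints I).Finite := hIf.subset fun u hu => hu.1
  have := hIf.fintype
  have := hYf.fintype
  have := hVf.fintype
  have hLa : ∀ u, skeletonMap A (a u) = 0 := fun u => by
    obtain ⟨c, hc⟩ := ha u
    rw [hc, hA.skeletonMap_affineFun]
  rw [finrank_range_add_finrank (skeletonMap A) (heightCoordinates I Y) a
    (hA.hex.heightCoordinates_surjective hY hY1) (fun h => hA.heightCoordinates_eq_zero hY2) hLa
    (fun u hu => hinj u fun z hz => congrFun hu (Sum.inl ⟨z, hz⟩)) ?_]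
  · rw [Module.finrank_fintype_fun_eq_card, Fintype.card_sum, Fintype.card_sum, add_assoc,
      Set.ncard_eq_toFinset_card', Set.ncard_eq_toFinset_card', Set.ncard_eq_toFinset_card',
      Set.toFinset_card, Set.toFinset_card, Set.toFinset_card]
  · intro h hh
    obtain ⟨u, hu⟩ := hker h hh
    refine ⟨u, ?_⟩
    rw [← sub_eq_zero, ← map_sub]
    have h0 : ∀ z ∈ I, (h - a u) z = 0 := fun z hz => sub_eq_zero.2 (hu z hz)
    have h1 : skeletonMap A (h - a u) = 0 := by rw [map_sub, hh, hLa, sub_zero]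
    rw [hA.skeletonMap_eq_zero_iff_of_eq_zero _ h0] at h1
    ext x
    rcases x with v | p | v
    · exact h0 v v.2
    · change outerSum I p _ = 0
      rw [outerSum_apply I _ _ h0, add_comm]
      exact h1.1 _ (hY p.2).1 _ (hY p.2).2.1
    · exact h1.2 v v.2.1

/-- The affine function with coefficients `c`, as a linear function of `c`. -/
def affineMap : ℝ × ℝ × ℝ →ₗ[ℝ] (ℤ × ℤ → ℝ) where
  toFun := affineFun
  map_add' c c' := by ext; simp only [affineFun, Prod.fst_add, Prod.snd_add, Pi.add_apply]; ring
  map_smul' t c := by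
    ext
    simp only [affineFun, Prod.smul_fst, Prod.smul_snd, smul_eq_mul, RingHom.id_apply,
      Pi.smul_apply]
    ring

/-! ### The rank when I contains a triangle -/

lemma dir_det (k : Fin 6) :
    (dir k).1 * (dir (k + 1)).2 - (dir k).2 * (dir (k + 1)).1 = 1 := by
  revert k; decide

lemma exists_affineFun (u : ℤ × ℤ) (k : Fin 6) (x y z : ℝ) :
    ∃ c, affineFun c u = x ∧ affineFun c (u + dir k) = y ∧ affineFun c (u + dir (k + 1)) = z := by
  have hdet : ((dir k).1 : ℝ) * (dir (k + 1)).2 - (dir k).2 * (dir (k + 1)).1 = 1 := by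
    exact_mod_cast dir_det k
  set b := (y - x) * (dir (k + 1)).2 - (z - x) * (dir k).2 with hb
  set c := (z - x) * (dir k).1 - (y - x) * (dir (k + 1)).1 with hc
  refine ⟨(x - b * u.1 - c * u.2, b, c), ?_, ?_, ?_⟩
  · simp only [affineFun]; ring
  · simp only [affineFun, Prod.fst_add, Prod.snd_add]
    push_cast
    linear_combination (y - x) * hdet
  · simp only [affineFun, Prod.fst_add, Prod.snd_add]
    push_cast
    linear_combination (z - x) * hdet

lemma affineFun_eq_zero {c : ℝ × ℝ × ℝ} {u : ℤ × ℤ} {k : Fin 6} (h0 : affineFun c u = 0)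
    (h1 : affineFun c (u + dir k) = 0) (h2 : affineFun c (u + dir (k + 1)) = 0) : c = 0 := by
  have hdet : ((dir k).1 : ℝ) * (dir (k + 1)).2 - (dir k).2 * (dir (k + 1)).1 = 1 := by
    exact_mod_cast dir_det k
  obtain ⟨x, b, c⟩ := c
  simp only [affineFun, Prod.fst_add, Prod.snd_add] at h0 h1 h2
  push_cast at h1 h2
  have hb : b = 0 := by
    linear_combination -b * hdet + ((dir (k + 1)).2 : ℝ) * (h1 - h0) - ((dir k).2 : ℝ) * (h2 - h0)
  have hc : c = 0 := by
    linear_combination -c * hdet + ((dir k).1 : ℝ) * (h2 - h0) - ((dir (k + 1)).1 : ℝ) * (h1 - h0)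
  subst hb hc
  simpa using h0

lemma IsInner.finrank_range_of_triangle (hA : IsInner A I)
    [Finite (coreGraph (dualGraph (unitTriangulation A))).edgeSet] {v : ℤ × ℤ} {k : Fin 6}
    (hv : v ∈ I) (hv1 : v + dir k ∈ I) (hv2 : v + dir (k + 1) ∈ I) :
    Module.finrank ℝ (LinearMap.range (skeletonMap A)) + 3 =
      I.ncard + (boundaryPoints I).ncard + (cornerPoints I).ncard := by
  have h3 : Module.finrank ℝ (ℝ × ℝ × ℝ) = 3 := by simp
  rw [← hA.hex.ncard_boundaryEdges hv hv1 hv2, ← h3]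
  refine hA.finrank_range subset_rfl ?_ (fun p hp => Or.inl hp) affineMap
    (fun c => ⟨c, rfl⟩) ?_ ?_
  · rintro ⟨u, j⟩ ⟨h1, h2, h3⟩ ⟨h4, h5, h6⟩
    dsimp only at *
    rw [reverse_left] at h6
    rcases hA.hex.side_of_triangle hv hv1 hv2 h1 h2 with h | h
    · exact h3 h
    · exact h6 h
  · intro c hc
    exact affineFun_eq_zero (hc v hv) (hc _ hv1) (hc _ hv2)
  · intro h hh
    obtain ⟨c, c0, c1, c2⟩ := exists_affineFun v k (h v) (h (v + dir k)) (h (v + dir (k + 1)))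
    refine ⟨c, fun z hz => sub_eq_zero.1 ?_⟩
    have hh' : skeletonMap A (h - affineFun c) = 0 := by
      rw [map_sub, hh, hA.skeletonMap_affineFun, sub_zero]
    have hb := ((hA.skeletonMap_eq_zero_iff _).1 hh').1
    refine hA.hex.eq_zero_of_rhombus (h - affineFun c) ?_ hv hv1 hv2 (sub_eq_zero.2 c0.symm)
      (sub_eq_zero.2 c1.symm) (sub_eq_zero.2 c2.symm) z hz
    intro w l hw hw1 hw2 hw3
    -- The short diagonal of the rhombus runs from w + dir l in direction l + 2; the bend across it
    -- is the rhombus relation.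
    have := hb (w + dir l) hw1 (l + 2) (by rwa [add_assoc, dir_add_two])
    rw [bend_dualEdge, add_assoc l 2 1, show (2 + 1 : Fin 6) = 3 from rfl,
      add_dir_add_dir_add_three, add_sub_assoc l, show (2 - 1 : Fin 6) = 1 from rfl,
      add_assoc w (dir l) (dir (l + 2)), dir_add_two] at this
    linarith

/-! ### The rank when I consists of the lattice points of a segment -/

lemma exists_dir_functional (j : Fin 6) : ∃ s t : ℤ, s * (dir j).1 + t * (dir j).2 = 1 := by
  fin_cases j
  · exact ⟨1, 0, rfl⟩
  · exact ⟨0, 1, rfl⟩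
  · exact ⟨0, 1, rfl⟩
  · exact ⟨-1, 0, rfl⟩
  · exact ⟨0, -1, rfl⟩
  · exact ⟨1, 0, rfl⟩

lemma IsInner.finrank_range_of_segment (hA : IsInner A I)
    [Finite (coreGraph (dualGraph (unitTriangulation A))).edgeSet] {p : ℤ × ℤ} {j : Fin 6}
    {n : ℕ} (hn : 1 ≤ n)
    (hI : ∀ x y : ℤ, p + x • dir j + y • dir (j + 1) ∈ I ↔ y = 0 ∧ 0 ≤ x ∧ x ≤ n) :
    Module.finrank ℝ (LinearMap.range (skeletonMap A)) + 3 =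
      I.ncard + (boundaryPoints I).ncard + (cornerPoints I).ncard := by
  have hI0 : ∀ x : ℤ, p + x • dir j ∈ I ↔ 0 ≤ x ∧ x ≤ n := fun x => by
    have := hI x 0
    simpa only [zero_smul, add_zero, true_and] using this
  have hI1 : ∀ z ∈ I, ∃ x : ℤ, z = p + x • dir j ∧ 0 ≤ x ∧ x ≤ n := fun z hz => by
    obtain ⟨x, y, rfl⟩ := exists_frame p z j
    obtain ⟨rfl, h⟩ := (hI x y).1 hz
    exact ⟨x, by simp, h⟩
  have d0 : ∀ x : ℤ, p + x • dir j + dir j ∈ I ↔ 0 ≤ x + 1 ∧ x + 1 ≤ n := fun x => by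
    rw [show p + x • dir j + dir j = p + (x + 1) • dir j by module, hI0]
  have d1 : ∀ x : ℤ, p + x • dir j + dir (j + 1) ∉ I := fun x => by
    rw [show p + x • dir j + dir (j + 1) = p + x • dir j + (1 : ℤ) • dir (j + 1) by module, hI]
    omega
  have d2 : ∀ x : ℤ, p + x • dir j + dir (j + 2) ∉ I := fun x => by
    rw [dir_add_two', show p + x • dir j + (dir (j + 1) - dir j) =
      p + (x - 1) • dir j + (1 : ℤ) • dir (j + 1) by module, hI]
    omega
  have d3 : ∀ x : ℤ, p + x • dir j + dir (j + 3) ∈ I ↔ 0 ≤ x - 1 ∧ x - 1 ≤ n := fun x => by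
    rw [dir_add_three, show p + x • dir j + -dir j = p + (x - 1) • dir j by module, hI0]
  have d4 : ∀ x : ℤ, p + x • dir j + dir (j + 4) ∉ I := fun x => by
    rw [dir_add_four, show p + x • dir j + -dir (j + 1) =
      p + x • dir j + (-1 : ℤ) • dir (j + 1) by module, hI]
    omega
  have d5 : ∀ x : ℤ, p + x • dir j + dir (j - 1) ∉ I := fun x => by
    rw [dir_sub_one, show p + x • dir j + (dir j - dir (j + 1)) =
      p + (x + 1) • dir j + (-1 : ℤ) • dir (j + 1) by module, hI]
    omega
  have hinj : Function.Injective fun i : ℤ => p + i • dir j := fun i i' h => by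
    refine (frame_inj (k := j) (y := 0) (y' := 0) ?_).1
    simpa using h
  have hIimg : I = (fun i : ℤ => p + i • dir j) '' Set.Icc 0 (n : ℤ) := by
    ext z
    constructor
    · intro hz
      obtain ⟨x, rfl, hx⟩ := hI1 z hz
      exact ⟨x, hx, rfl⟩
    · rintro ⟨x, hx, rfl⟩
      exact (hI0 x).2 hx
  have hcard : I.ncard = n + 1 := by
    rw [hIimg, Set.ncard_image_of_injective _ hinj, ← Finset.coe_Icc, Set.ncard_coe_finset,
      Int.card_Icc]
    omega
  have hB : boundaryPoints I = I := by
    ext z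
    refine ⟨fun hz => hz.1, fun hz => ⟨hz, j + 1, ?_⟩⟩
    obtain ⟨x, rfl, -⟩ := hI1 z hz
    exact d1 x
  have hp0 : p + (0 : ℤ) • dir j ∈ I := (hI0 0).2 (by omega)
  have hpn : p + (n : ℤ) • dir j ∈ I := (hI0 n).2 (by omega)
  have hV : cornerPoints I = {p + (0 : ℤ) • dir j, p + (n : ℤ) • dir j} := by
    ext z
    constructor
    · rintro ⟨hz, k, k1, k2, k3⟩
      obtain ⟨x, rfl, hx⟩ := hI1 z hz
      by_contra hc
      have hx0 : x ≠ 0 := by rintro rfl; exact hc (Or.inl rfl)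
      have hxn : x ≠ n := by rintro rfl; exact hc (Or.inr rfl)
      have e0 := (d0 x).2 (by omega)
      have e3 := (d3 x).2 (by omega)
      have : k - 1 = j ∨ k = j ∨ k + 1 = j ∨ k - 1 = j + 3 ∨ k = j + 3 ∨ k + 1 = j + 3 := by
        clear * -; revert j k; decide
      rcases this with h | h | h | h | h | h
      · exact k1 (h ▸ e0)
      · exact k2 (h ▸ e0)
      · exact k3 (h ▸ e0)
      · exact k1 (h ▸ e3)
      · exact k2 (h ▸ e3)
      · exact k3 (h ▸ e3)
    · rintro (rfl | rfl)
      · refine ⟨hp0, j + 3, ?_, ?_, ?_⟩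
        · rw [add_sub_assoc]; exact d2 0
        · rw [d3]; omega
        · rw [add_assoc j]; exact d4 0
      · refine ⟨hpn, j, d5 n, ?_, d1 n⟩
        rw [d0]; omega
  have hVcard : (cornerPoints I).ncard = 2 := by
    rw [hV]
    refine Set.ncard_pair fun h => ?_
    have := hinj h
    omega
  -- Every edge of the segment is a boundary edge in both orientations; only direction j is kept.
  set Y : Set ((ℤ × ℤ) × Fin 6) := (fun i : ℤ => (p + i • dir j, j)) '' Set.Ico 0 (n : ℤ) with hY
  have hYcard : Y.ncard = n := by
    rw [hY, Set.ncard_image_of_injective _ (fun i i' h => hinj (congrArg Prod.fst h)),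
      ← Finset.coe_Ico, Set.ncard_coe_finset, Int.card_Ico]
    omega
  have hj3 : j + 3 ≠ j := by clear * -; revert j; decide
  obtain ⟨s, t, hst⟩ := exists_dir_functional j
  have hst' : (s : ℝ) * (dir j).1 + t * (dir j).2 = 1 := by exact_mod_cast hst
  -- The functional (s, t) is 1 on dir j, and the constant term is shifted so that it vanishes at p:
  -- φ c extends x ↦ c.1 + c.2 * x from the line to the plane.
  set φ : ℝ × ℝ →ₗ[ℝ] ℝ × ℝ × ℝ :=
    LinearMap.prod (LinearMap.fst ℝ ℝ ℝ - (s * p.1 + t * p.2 : ℝ) • LinearMap.snd ℝ ℝ ℝ)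
      (LinearMap.prod ((s : ℝ) • LinearMap.snd ℝ ℝ ℝ) ((t : ℝ) • LinearMap.snd ℝ ℝ ℝ)) with hφ
  have hval : ∀ (c : ℝ × ℝ) (x : ℤ), affineMap (φ c) (p + x • dir j) = c.1 + c.2 * x := by
    intro c x
    have hc : φ c = (c.1 - (s * p.1 + t * p.2) * c.2, s * c.2, t * c.2) := rfl
    simp only [affineMap, affineFun, hc, LinearMap.coe_mk, AddHom.coe_mk, Prod.fst_add,
      Prod.snd_add, Prod.smul_fst, Prod.smul_snd, smul_eq_mul]
    push_cast
    linear_combination c.2 * x * hst'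
  have key := hA.finrank_range (Y := Y) ?_ ?_ ?_ (affineMap.comp φ) (fun c => ⟨φ c, rfl⟩) ?_ ?_
  · rw [hYcard, Module.finrank_prod, Module.finrank_self] at key
    rw [hB]
    omega
  · rintro _ ⟨x, ⟨h0, h1⟩, rfl⟩
    exact ⟨(hI0 x).2 (by omega), (d0 x).2 (by omega), d1 x⟩
  · rintro _ ⟨x, -, rfl⟩ ⟨y, -, h⟩
    exact hj3 (congrArg Prod.snd h).symm
  · rintro ⟨u, k⟩ ⟨h1, h2, h3⟩
    obtain ⟨x, rfl, hx⟩ := hI1 u h1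
    dsimp only at h2 h3 ⊢
    have hk : k = j ∨ k = j + 3 := by
      have c1 : k ≠ j + 1 := by rintro rfl; exact d1 x h2
      have c2 : k ≠ j + 2 := by rintro rfl; exact d2 x h2
      have c4 : k ≠ j + 4 := by rintro rfl; exact d4 x h2
      have c5 : k ≠ j - 1 := by rintro rfl; exact d5 x h2
      clear * - c1 c2 c4 c5; revert j k; decide
    rcases hk with rfl | rfl
    · left
      have := (d0 x).1 h2
      exact ⟨x, ⟨by omega, by omega⟩, rfl⟩
    · right
      have := (d3 x).1 h2
      refine ⟨x - 1, ⟨by omega, by omega⟩, ?_⟩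
      rw [dir_add_three, add_assoc j, show (3 + 3 : Fin 6) = 0 from rfl, add_zero,
        show p + x • dir j + -dir j = p + (x - 1) • dir j by module]
  · intro c hc
    have h0 := hc _ hp0
    have h1 := hc _ hpn
    rw [LinearMap.comp_apply, hval] at h0 h1
    have hn' : (n : ℝ) ≠ 0 := by positivity
    have hc1 : c.1 = 0 := by simpa using h0
    have hc2 : c.2 = 0 := by
      rw [hc1, zero_add] at h1
      exact (mul_eq_zero.1 h1).resolve_right (by exact_mod_cast hn')
    exact Prod.ext hc1 hc2
  · intro h hh
    refine ⟨(h p, h (p + dir j) - h p), fun z hz => ?_⟩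
    obtain ⟨x, rfl, hx0, hxn⟩ := hI1 z hz
    rw [LinearMap.comp_apply, hval]
    dsimp only
    lift x to ℕ using hx0
    have main : ∀ m : ℕ, m + 1 ≤ n →
        h (p + (m : ℤ) • dir j) = h p + (h (p + dir j) - h p) * m ∧
        h (p + ((m + 1 : ℕ) : ℤ) • dir j) = h p + (h (p + dir j) - h p) * (m + 1 : ℕ) := by
      intro m
      induction m with
      | zero => intro _; simp
      | succ m ih =>
        intro hm
        obtain ⟨i1, i2⟩ := ih (by omega)
        refine ⟨i2, ?_⟩
        have := hA.second_difference hh (u := p + ((m + 1 : ℕ) : ℤ) • dir j) (j := j)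
          ((hI0 _).2 (by omega)) ((d0 _).2 (by omega)) (d1 _) (d2 _) ((d3 _).2 (by omega))
        rw [dir_add_three, show p + ((m + 1 : ℕ) : ℤ) • dir j + -dir j = p + (m : ℤ) • dir j by
            push_cast; module,
          show p + ((m + 1 : ℕ) : ℤ) • dir j + dir j = p + ((m + 1 + 1 : ℕ) : ℤ) • dir j by
            push_cast; module, i1, i2] at this
        push_cast at this ⊢
        linarith
    rcases Nat.eq_zero_or_pos x with rfl | hx
    · simp
    · obtain ⟨m, rfl⟩ : ∃ m, x = m + 1 := ⟨x - 1, by omega⟩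
      exact_mod_cast (main m (by omega)).2

lemma IsInner.finrank_range_add_three (hA : IsInner A I)
    [Finite (coreGraph (dualGraph (unitTriangulation A))).edgeSet] (h2 : 2 ≤ I.ncard) :
    Module.finrank ℝ (LinearMap.range (skeletonMap A)) + 3 =
      I.ncard + (boundaryPoints I).ncard + (cornerPoints I).ncard := by
  rcases hA.hex.triangle_or_segment (hA.finite.subset hA.subset) h2 with
    ⟨u, k, h⟩ | ⟨p, j, n, hn, h⟩
  · exact hA.finrank_range_of_triangle h.1 h.2.1 h.2.2
  · exact hA.finrank_range_of_segment hn h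

/-! ### Lattice lengths of dual edges -/

/-- The two displacement vectors are multiples of each other by factors σ, τ of modulus at most 1.
Bézout coefficients for the first direction give l = σ * l' * n with an integer n. If l > 0, then
|σ| = 1 and n ≠ 0, so l ≥ l'; if l = 0, then l' = 0. -/
lemma latticeLength_le {S : Set (ℝ × ℝ)} {l l' : ℝ} (h : HasLatticeLength S l)
    (h' : HasLatticeLength S l') : l' ≤ l := by
  obtain ⟨h0, p, ⟨u, v⟩, ⟨x, y, hxy⟩, hS⟩ := h
  obtain ⟨h0', p', ⟨u', v'⟩, ⟨x', y', hxy'⟩, hS'⟩ := h'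
  dsimp only at hxy hxy'
  have key : ∀ {p p' w w' : ℝ × ℝ}, segment ℝ p (p + w) ⊆ segment ℝ p' (p' + w') →
      ∃ σ : ℝ, |σ| ≤ 1 ∧ w = σ • w' := by
    intro p p' w w' hsub
    have h1 := hsub (left_mem_segment ℝ p (p + w))
    have h2 := hsub (right_mem_segment ℝ p (p + w))
    rw [segment_eq_image'] at h1 h2
    obtain ⟨θ, hθ, h1⟩ := h1
    obtain ⟨η, hη, h2⟩ := h2
    dsimp only at h1 h2
    rw [add_sub_cancel_left] at h1 h2
    refine ⟨η - θ, abs_le.2 ⟨by linarith [hθ.2, hη.1], by linarith [hθ.1, hη.2]⟩, ?_⟩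
    rw [sub_smul, ← add_right_inj p, ← h2, ← h1]
    abel
  obtain ⟨σ, hσ, e1⟩ := key (hS.symm.trans hS').subset
  obtain ⟨τ, hτ, e2⟩ := key (hS'.symm.trans hS).subset
  simp only [toPlane, Prod.smul_mk, smul_eq_mul, Prod.mk.injEq] at e1 e2
  have hxy1 : (x : ℝ) * u + y * v = 1 := by exact_mod_cast hxy
  have hxy1' : (x' : ℝ) * u' + y' * v' = 1 := by exact_mod_cast hxy'
  have f1 : l = σ * l' * (x * u' + y * v') := by
    linear_combination -l * hxy1 + x * e1.1 + y * e1.2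
  have f2 : l = σ * τ * l := by
    linear_combination (-l + σ * τ * l) * hxy1 + x * e1.1 + y * e1.2 + σ * x * e2.1 + σ * y * e2.2
  rcases eq_or_lt_of_le h0 with hl | hl
  · have : l' = τ * l * (x' * u + y' * v) := by
      linear_combination -l' * hxy1' + x' * e2.1 + y' * e2.2
    rw [this, ← hl]
    simp
  · have hστ : σ * τ = 1 := by
      have : (σ * τ - 1) * l = 0 := by linarith
      rcases mul_eq_zero.1 this with h | h
      · linarith
      · exact absurd h hl.ne'
    have hσ1 : |σ| = 1 := by
      refine le_antisymm hσ ?_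
      have : |σ| * |τ| = 1 := by rw [← abs_mul, hστ, abs_one]
      nlinarith [abs_nonneg σ, abs_nonneg τ]
    set n : ℤ := x * u' + y * v' with hn
    have hn' : ((x : ℝ) * u' + y * v') = n := by rw [hn]; push_cast; ring
    rw [hn'] at f1
    have hn0 : n ≠ 0 := by
      intro h
      rw [h, Int.cast_zero, mul_zero] at f1
      exact hl.ne' f1
    have hn1 : (1 : ℝ) ≤ |(n : ℝ)| := by exact_mod_cast Int.one_le_abs hn0
    have : l = l' * |(n : ℝ)| := by
      rw [← abs_of_nonneg h0, f1, abs_mul, abs_mul, hσ1, one_mul, abs_of_nonneg h0']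
    rw [this]
    nlinarith

lemma latticeLength_unique {S : Set (ℝ × ℝ)} {l l' : ℝ} (h : HasLatticeLength S l)
    (h' : HasLatticeLength S l') : l = l' :=
  le_antisymm (latticeLength_le h' h) (latticeLength_le h h')

lemma convex_tropicalDual (h : ℤ × ℤ → ℝ) (F : Set (ℤ × ℤ)) : Convex ℝ (tropicalDual A h F) := by
  intro p hp q hq α β hα hβ hαβ b hb z hz
  have h1 := mul_le_mul_of_nonneg_left (hp b hb z hz) hα
  have h2 := mul_le_mul_of_nonneg_left (hq b hb z hz) hβ
  simp only [Prod.fst_add, Prod.snd_add, Prod.smul_fst, Prod.smul_snd, smul_eq_mul]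
  linear_combination h1 + h2 + (h z - h b) * hαβ

/-- The part of the tropical curve dual to an inner edge has the bend as its lattice length. -/
lemma hasLatticeLength_dualEdge {h : ℤ × ℤ → ℝ}
    (hh : regularSubdivision A h = unitTriangulation A) {u : ℤ × ℤ} {k : Fin 6}
    (hT : unitTriangle u k ∈ unitTriangulation A)
    (hT' : unitTriangle u (k - 1) ∈ unitTriangulation A) :
    HasLatticeLength (tropicalDual A h (commonFace (dualEdge u k))) (bend h (dualEdge u k)) := by
  have hA := unitTriangle_mem.1 hT
  have hA' := unitTriangle_mem.1 hT'
  rw [← hh] at hT hT'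
  obtain ⟨r, s, t, hle, hmem, -⟩ := hT
  obtain ⟨r', s', t', hle', hmem', -⟩ := hT'
  rw [sub_add_cancel] at hA'
  have m0 := ((hmem u).1 (by simp [unitTriangle])).2
  have m1 := ((hmem (u + dir k)).1 (by simp [unitTriangle])).2
  have m2 := ((hmem (u + dir (k + 1))).1 (by simp [unitTriangle])).2
  have m0' := ((hmem' u).1 (by simp [unitTriangle])).2
  have m1' := ((hmem' (u + dir k)).1 (by simp [unitTriangle])).2
  have m2' := ((hmem' (u + dir (k - 1))).1 (by simp [unitTriangle])).2
  have m3 := hle _ hA'.2.1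
  rw [commonFace_dualEdge, bend_dualEdge]
  set b := h (u + dir (k - 1)) + h (u + dir (k + 1)) - h u - h (u + dir k) with hb
  have hdet : ((dir k).1 : ℝ) * (dir (k + 1)).2 - (dir k).2 * (dir (k + 1)).1 = 1 := by
    exact_mod_cast dir_det k
  have k1 : ((dir (k - 1)).1 : ℝ) = (dir k).1 - (dir (k + 1)).1 := by
    rw [dir_sub_one]; simp
  have k2 : ((dir (k - 1)).2 : ℝ) = (dir k).2 - (dir (k + 1)).2 := by
    rw [dir_sub_one]; simp
  simp only [Prod.fst_add, Prod.snd_add, Int.cast_add, k1, k2] at m0 m1 m2 m0' m1' m2' m3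
  have hb0 : 0 ≤ b := by rw [hb]; linarith
  have x1 : r - r' = -b * (dir k).2 := by
    linear_combination (-(r - r')) * hdet + ((dir (k + 1)).2 : ℝ) * (m1 - m0 - m1' + m0') -
      ((dir k).2 : ℝ) * (m2 - m0 + m2' - m1')
  have x2 : s - s' = b * (dir k).1 := by
    linear_combination (-(s - s')) * hdet - ((dir (k + 1)).1 : ℝ) * (m1 - m0 - m1' + m0') +
      ((dir k).1 : ℝ) * (m2 - m0 + m2' - m1')
  -- The supporting planes of the two triangles yield the ends (-r, -s) and (-r', -s'). The
  -- direction is dir k turned by a right angle, primitive by `dir_det`.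
  refine ⟨hb0, (-r, -s), (-(dir k).2, (dir k).1), ⟨(dir (k + 1)).1, (dir (k + 1)).2, ?_⟩, ?_⟩
  · linear_combination dir_det k
  have hend : ((-r, -s) : ℝ × ℝ) + b • toPlane (-(dir k).2, (dir k).1) = (-r', -s') := by
    ext
    · simp only [toPlane, Prod.fst_add, Prod.smul_fst, smul_eq_mul]
      push_cast
      linear_combination -x1
    · simp only [toPlane, Prod.snd_add, Prod.smul_snd, smul_eq_mul]
      linear_combination -x2
  apply Set.Subset.antisymm
  · rintro ⟨x, y⟩ hp
    have c1 := hp u (by simp) _ hA.2.1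
    have c2 := hp (u + dir k) (by simp) _ hA.1
    have c3 := hp u (by simp) _ hA.2.2
    have c4 := hp u (by simp) _ hA'.2.1
    simp only [Prod.fst_add, Prod.snd_add, Int.cast_add, k1, k2] at c1 c2 c3 c4
    have c5 : (x + r) * (dir k).1 + (y + s) * (dir k).2 = 0 := by linarith
    set τ : ℝ := (x + r) * (dir (k + 1)).1 + (y + s) * (dir (k + 1)).2 with hτ
    have t1 : x = -r + τ * -(dir k).2 := by
      linear_combination (-(x + r)) * hdet + ((dir (k + 1)).2 : ℝ) * c5
    have t2 : y = -s + τ * (dir k).1 := by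
      linear_combination (-(y + s)) * hdet - ((dir (k + 1)).1 : ℝ) * c5
    have t3 : 0 ≤ τ := by rw [hτ]; linarith
    have t4 : τ ≤ b := by rw [hτ, hb]; linarith
    rw [segment_eq_image']
    -- For b = 0 also τ = 0, and the value 0 of the quotient is the right one.
    have hθ : τ / b * b = τ := by
      rcases eq_or_lt_of_le hb0 with h0 | h0
      · rw [← h0] at t4 ⊢
        rw [mul_zero]
        exact le_antisymm t3 t4
      · exact div_mul_cancel₀ _ h0.ne'
    refine ⟨τ / b, ⟨div_nonneg t3 hb0, div_le_one_of_le₀ t4 hb0⟩, ?_⟩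
    dsimp only
    rw [add_sub_cancel_left, smul_smul, hθ]
    ext
    · simp only [toPlane, Prod.fst_add, Prod.smul_fst, smul_eq_mul]
      push_cast
      exact t1.symm
    · simp only [toPlane, Prod.snd_add, Prod.smul_snd, smul_eq_mul]
      exact t2.symm
  · refine (convex_tropicalDual h _).segment_subset ?_ ?_
    · rintro v (rfl | rfl) z hz
      · have := hle z hz
        linarith
      · have := hle z hz
        simp only [Prod.fst_add, Prod.snd_add, Int.cast_add]
        linarith
    · rw [hend]
      rintro v (rfl | rfl) z hz
      · have := hle' z hz
        linarith
      · have := hle' z hz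
        simp only [Prod.fst_add, Prod.snd_add, Int.cast_add]
        linarith

/-! ### Height functions that induce the honeycomb triangulation -/

lemma not_collinear_unitTriangle (u : ℤ × ℤ) (k : Fin 6) :
    ¬ Collinear ℝ (toPlane '' (unitTriangle u k : Set (ℤ × ℤ))) := by
  intro h
  obtain ⟨v, hv⟩ := (collinear_iff_of_mem (p₀ := toPlane u)
    (Set.mem_image_of_mem _ (by simp [unitTriangle]))).1 h
  obtain ⟨x, hx⟩ := hv (toPlane (u + dir k)) (Set.mem_image_of_mem _ (by simp [unitTriangle]))
  obtain ⟨y, hy⟩ := hv (toPlane (u + dir (k + 1)))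
    (Set.mem_image_of_mem _ (by simp [unitTriangle]))
  have hdet : ((dir k).1 : ℝ) * (dir (k + 1)).2 - (dir k).2 * (dir (k + 1)).1 = 1 := by
    exact_mod_cast dir_det k
  simp only [toPlane, Prod.ext_iff, Prod.fst_add, Prod.snd_add, Int.cast_add, vadd_eq_add,
    Prod.smul_fst, Prod.smul_snd, smul_eq_mul] at hx hy
  have a1 : ((dir k).1 : ℝ) = x * v.1 := by linarith [hx.1]
  have a2 : ((dir k).2 : ℝ) = x * v.2 := by linarith [hx.2]
  have b1 : ((dir (k + 1)).1 : ℝ) = y * v.1 := by linarith [hy.1]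
  have b2 : ((dir (k + 1)).2 : ℝ) = y * v.2 := by linarith [hy.2]
  rw [a1, a2, b1, b2] at hdet
  linarith

/-! ### Excluding further cells of a regular subdivision -/

lemma exists_cross_ne_zero {S : Set (ℤ × ℤ)} (hS : ¬ Collinear ℝ (toPlane '' S)) :
    ∃ x ∈ S, ∃ y ∈ S, ∃ z ∈ S,
      (x.1 - z.1) * (y.2 - z.2) - (x.2 - z.2) * (y.1 - z.1) ≠ 0 := by
  by_contra! hc
  apply hS
  rcases S.eq_empty_or_nonempty with rfl | ⟨z, hz⟩
  · simp [collinear_empty]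
  by_cases hx : ∃ x ∈ S, x ≠ z
  swap
  · push Not at hx
    have : S = {z} := Set.eq_singleton_iff_unique_mem.2 ⟨hz, hx⟩
    rw [this, Set.image_singleton]
    exact collinear_singleton _ _
  obtain ⟨x, hx, hxz⟩ := hx
  refine (collinear_iff_of_mem (p₀ := toPlane z) (Set.mem_image_of_mem _ hz)).2 ⟨toPlane x - toPlane z, ?_⟩
  rintro _ ⟨y, hy, rfl⟩
  have hcr := hc x hx y hy z hz
  have hcr' : ((x.1 : ℝ) - z.1) * (y.2 - z.2) - (x.2 - z.2) * (y.1 - z.1) = 0 := by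
    exact_mod_cast hcr
  by_cases h1 : x.1 = z.1
  · have h2 : (x.2 : ℝ) - z.2 ≠ 0 := by
      intro h2
      exact hxz (Prod.ext h1 (by exact_mod_cast sub_eq_zero.1 h2))
    refine ⟨((y.2 : ℝ) - z.2) / (x.2 - z.2), ?_⟩
    have h1' : (x.1 : ℝ) = z.1 := by exact_mod_cast h1
    rw [h1', sub_self, zero_mul, zero_sub, neg_eq_zero] at hcr'
    have h3 := (mul_eq_zero.1 hcr').resolve_left h2
    ext
    · simp only [toPlane, vadd_eq_add, Prod.fst_add, Prod.smul_fst, Prod.fst_sub, smul_eq_mul, h1',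
        sub_self, mul_zero, zero_add]
      linarith
    · simp only [toPlane, vadd_eq_add, Prod.snd_add, Prod.smul_snd, Prod.snd_sub, smul_eq_mul]
      rw [div_mul_cancel₀ _ h2]
      ring
  · have h2 : (x.1 : ℝ) - z.1 ≠ 0 := by
      intro h2
      exact h1 (by exact_mod_cast sub_eq_zero.1 h2)
    refine ⟨((y.1 : ℝ) - z.1) / (x.1 - z.1), ?_⟩
    ext
    · simp only [toPlane, vadd_eq_add, Prod.fst_add, Prod.smul_fst, Prod.fst_sub, smul_eq_mul]
      rw [div_mul_cancel₀ _ h2]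
      ring
    · simp only [toPlane, vadd_eq_add, Prod.snd_add, Prod.smul_snd, Prod.snd_sub, smul_eq_mul]
      field_simp
      linarith

/-- Uniqueness of digits in base N: N divides y, so y = 0, and then N divides x. -/
lemma eq_zero_of_mul_add {N x y m : ℤ} (hx : |x| < N) (hy : |y| < N)
    (h : N * x + y = N ^ 2 * m) : x = 0 ∧ y = 0 := by
  have hN : 0 < N := (abs_nonneg x).trans_lt hx
  have hy0 : y = 0 := by
    refine Int.eq_zero_of_abs_lt_dvd (m := N) ⟨N * m - x, ?_⟩ hy
    linear_combination h
  subst hy0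
  refine ⟨?_, rfl⟩
  refine Int.eq_zero_of_abs_lt_dvd (m := N) ⟨m, ?_⟩ hx
  have : N * (x - N * m) = 0 := by linear_combination h
  rcases mul_eq_zero.1 this with h | h
  · omega
  · linarith

/-- Every point of the convex hull of `A` in general position lies in a unit triangle with vertices
in `A`. -/
def CoversHull (A : Set (ℤ × ℤ)) : Prop :=
  ∀ p ∈ convexHull ℝ (toPlane '' A), (∀ n : ℤ, p.1 ≠ n ∧ p.2 ≠ n ∧ p.1 + p.2 ≠ n) →
    ∃ u k, unitTriangle u k ∈ unitTriangulation A ∧ ∃ α β γ : ℝ, 0 ≤ α ∧ 0 ≤ β ∧ 0 ≤ γ ∧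
      α + β + γ = 1 ∧
      p = α • toPlane u + β • toPlane (u + dir k) + γ • toPlane (u + dir (k + 1))

/-- A point in general position in the triangle spanned by three lattice points. -/
lemma exists_generic_point {x y z : ℤ × ℤ}
    (hcr : (x.1 - z.1) * (y.2 - z.2) - (x.2 - z.2) * (y.1 - z.1) ≠ 0) :
    ∃ α β γ : ℝ, 0 < α ∧ 0 < β ∧ 0 < γ ∧ α + β + γ = 1 ∧ ∀ n : ℤ,
      α * x.1 + β * y.1 + γ * z.1 ≠ n ∧ α * x.2 + β * y.2 + γ * z.2 ≠ n ∧
      α * x.1 + β * y.1 + γ * z.1 + (α * x.2 + β * y.2 + γ * z.2) ≠ n := by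
  -- With weights 1/N and 1/N², an integral value would make both differences of that coordinate
  -- vanish, against `hcr`. N exceeds the differences of x.1 + x.2 as well, and the summand 2 makes
  -- the third weight positive.
  obtain ⟨N, hN⟩ : ∃ N : ℤ, N = |x.1 - z.1| + |x.2 - z.2| + |y.1 - z.1| + |y.2 - z.2| + 2 :=
    ⟨_, rfl⟩
  have a1 := abs_nonneg (x.1 - z.1)
  have a2 := abs_nonneg (x.2 - z.2)
  have a3 := abs_nonneg (y.1 - z.1)
  have a4 := abs_nonneg (y.2 - z.2)
  have hN2 : 2 ≤ N := by omega
  have hNR : (2 : ℝ) ≤ N := by exact_mod_cast hN2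
  have hN0 : (N : ℝ) ≠ 0 := by positivity
  have key : ∀ (i j l n : ℤ), |i - l| < N → |j - l| < N → ¬ (i - l = 0 ∧ j - l = 0) →
      1 / (N : ℝ) * i + 1 / (N : ℝ) ^ 2 * j + (1 - 1 / (N : ℝ) - 1 / (N : ℝ) ^ 2) * l ≠ n := by
    intro i j l n hi hj hne h
    apply hne
    refine eq_zero_of_mul_add hi hj (m := n - l) ?_
    field_simp at h
    have : (N : ℝ) * (i - l) + (j - l) = (N : ℝ) ^ 2 * (n - l) := by linear_combination h
    exact_mod_cast this
  refine ⟨1 / (N : ℝ), 1 / (N : ℝ) ^ 2, 1 - 1 / (N : ℝ) - 1 / (N : ℝ) ^ 2, by positivity,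
    by positivity, ?_, by ring, fun n => ⟨?_, ?_, ?_⟩⟩
  · have h1 : 1 / (N : ℝ) ≤ 1 / 2 := one_div_le_one_div_of_le (by norm_num) hNR
    have h2 : 1 / (N : ℝ) ^ 2 ≤ 1 / 4 := one_div_le_one_div_of_le (by norm_num) (by nlinarith)
    linarith
  · refine key _ _ _ n (by omega) (by omega) fun h => hcr ?_
    rw [h.1, h.2]; ring
  · refine key _ _ _ n (by omega) (by omega) fun h => hcr ?_
    rw [h.1, h.2]; ring
  · have h1 := abs_add_le (x.1 - z.1) (x.2 - z.2)
    have h2 := abs_add_le (y.1 - z.1) (y.2 - z.2)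
    have := key (x.1 + x.2) (y.1 + y.2) (z.1 + z.2) n
      (by rw [show x.1 + x.2 - (z.1 + z.2) = x.1 - z.1 + (x.2 - z.2) by ring]; omega)
      (by rw [show y.1 + y.2 - (z.1 + z.2) = y.1 - z.1 + (y.2 - z.2) by ring]; omega)
      fun h => hcr (by
        rw [show x.2 - z.2 = -(x.1 - z.1) by linarith [h.1],
          show y.2 - z.2 = -(y.1 - z.1) by linarith [h.2]]; ring)
    push_cast at this
    intro h
    apply this
    linear_combination h

lemma convex_combo_three {C : Set (ℝ × ℝ)} (hC : Convex ℝ C) {x y z : ℝ × ℝ} (hx : x ∈ C)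
    (hy : y ∈ C) (hz : z ∈ C) {α β γ : ℝ} (hα : 0 ≤ α) (hβ : 0 ≤ β) (hγ : 0 ≤ γ)
    (h : α + β + γ = 1) : α • x + β • y + γ • z ∈ C := by
  have := hC.sum_mem (t := Finset.univ) (w := ![α, β, γ]) (z := ![x, y, z])
    (fun i _ => by fin_cases i <;> assumption) (by simpa [Fin.sum_univ_three] using h)
    (fun i _ => by fin_cases i <;> assumption)
  simpa [Fin.sum_univ_three] using this

/-- If all unit triangles are cells of a regular subdivision, then there are no other cells. -/
lemma regularSubdivision_eq (hA : CoversHull A) {h : ℤ × ℤ → ℝ}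
    (hh : unitTriangulation A ⊆ regularSubdivision A h) :
    regularSubdivision A h = unitTriangulation A := by
  refine Set.Subset.antisymm ?_ hh
  rintro S ⟨r, s, t, hle, hmem, hcol⟩
  obtain ⟨x, hx, y, hy, z, hz, hcr⟩ := exists_cross_ne_zero hcol
  rw [Finset.mem_coe, hmem] at hx hy hz
  -- A point p inside the triangle xyz lies in a unit triangle T. The plane of S is below h at the
  -- vertices of T, so at p it is below the plane of T; the plane of T is below h at x, y, z, so at
  -- p the reverse holds. Equality at p with positive weights gives equality at x, y, z: the planes
  -- agree, and S = T.
  obtain ⟨α, β, γ, hα, hβ, hγ, hsum, hgen⟩ := exists_generic_point hcr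
  obtain ⟨u, k, hT, α', β', γ', hα', hβ', hγ', hsum', hp⟩ :=
    hA (α • toPlane x + β • toPlane y + γ • toPlane z) (by
      refine convexHull_mono (s := toPlane '' {x, y, z}) ?_ ?_
      · rintro _ ⟨w, (rfl | rfl | rfl), rfl⟩
        exacts [⟨_, hx.1, rfl⟩, ⟨_, hy.1, rfl⟩, ⟨_, hz.1, rfl⟩]
      · have hsub := subset_convexHull ℝ (toPlane '' {x, y, z})
        have hconv := convex_convexHull ℝ (toPlane '' {x, y, z})
        exact convex_combo_three hconv (hsub ⟨x, by simp, rfl⟩) (hsub ⟨y, by simp, rfl⟩)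
          (hsub ⟨z, by simp, rfl⟩) hα.le hβ.le hγ.le hsum)
      (by
        intro n
        simpa [toPlane] using hgen n)
  obtain ⟨r', s', t', hle', hmem', -⟩ := hh hT
  have hAT := unitTriangle_mem.1 hT
  have m0 := ((hmem' u).1 (by simp [unitTriangle])).2
  have m1 := ((hmem' (u + dir k)).1 (by simp [unitTriangle])).2
  have m2 := ((hmem' (u + dir (k + 1))).1 (by simp [unitTriangle])).2
  have l0 := mul_le_mul_of_nonneg_left (hle u hAT.1) hα'
  have l1 := mul_le_mul_of_nonneg_left (hle _ hAT.2.1) hβ'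
  have l2 := mul_le_mul_of_nonneg_left (hle _ hAT.2.2) hγ'
  rw [← m0] at l0
  rw [← m1] at l1
  rw [← m2] at l2
  have p1 := congrArg Prod.fst hp
  have p2 := congrArg Prod.snd hp
  simp only [toPlane, Prod.fst_add, Prod.snd_add, Prod.smul_fst, Prod.smul_snd, smul_eq_mul,
    Int.cast_add] at p1 p2 l0 l1 l2
  have hlow : α * (r * x.1 + s * x.2 + t) + β * (r * y.1 + s * y.2 + t) +
      γ * (r * z.1 + s * z.2 + t) ≤ α * (r' * x.1 + s' * x.2 + t') +
      β * (r' * y.1 + s' * y.2 + t') + γ * (r' * z.1 + s' * z.2 + t') := by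
    linear_combination l0 + l1 + l2 + (r - r') * p1 + (s - s') * p2 + (t - t') * (hsum - hsum')
  have gx := hle' x hx.1
  have gy := hle' y hy.1
  have gz := hle' z hz.1
  rw [← hx.2] at gx
  rw [← hy.2] at gy
  rw [← hz.2] at gz
  have qx := mul_le_mul_of_nonneg_left gx hα.le
  have qy := mul_le_mul_of_nonneg_left gy hβ.le
  have qz := mul_le_mul_of_nonneg_left gz hγ.le
  have ex := mul_left_cancel₀ hα.ne' (le_antisymm qx (by linarith))
  have ey := mul_left_cancel₀ hβ.ne' (le_antisymm qy (by linarith))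
  have ez := mul_left_cancel₀ hγ.ne' (le_antisymm qz (by linarith))
  have hcr' : ((x.1 : ℝ) - z.1) * (y.2 - z.2) - (x.2 - z.2) * (y.1 - z.1) ≠ 0 := by
    exact_mod_cast hcr
  have hr : r' = r := by
    refine mul_left_cancel₀ hcr' ?_
    linear_combination ((y.2 : ℝ) - z.2) * (ex - ez) - ((x.2 : ℝ) - z.2) * (ey - ez)
  have hs : s' = s := by
    refine mul_left_cancel₀ hcr' ?_
    linear_combination ((x.1 : ℝ) - z.1) * (ey - ez) - ((y.1 : ℝ) - z.1) * (ex - ez)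
  subst hr hs
  have ht : t' = t := by linarith
  subst ht
  have : S = unitTriangle u k := Finset.ext fun w => (hmem w).trans (hmem' w).symm
  rw [this]
  exact hT

/-- The quadratic form that is invariant under the symmetries of the triangular lattice. -/
def hexForm (z : ℤ × ℤ) : ℤ := z.1 ^ 2 + z.1 * z.2 + z.2 ^ 2

/-! ### The height function q and its perturbations -/

lemma hexForm_frame (k : Fin 6) (x y : ℤ) :
    hexForm (x • dir k + y • dir (k + 1)) = hexForm (x, y) := by
  fin_cases k <;> simp [hexForm, dir, show (5 + 1 : Fin 6) = 0 from rfl] <;> ring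

lemma mul_sub_one_nonneg (n : ℤ) : 0 ≤ n * (n - 1) := by
  rcases le_or_gt n 0 with h | h
  · nlinarith
  · nlinarith

/-- In the frame of the triangle, q minus its affine interpolant is x² + xy + y² - x - y, half of
x(x - 1) + y(y - 1) + (x + y)(x + y - 1). These terms are nonnegative integers and all vanish only
at the three vertices, so the gap elsewhere is at least 1. -/
lemma exists_hexForm_support (u : ℤ × ℤ) (k : Fin 6) :
    ∃ c, (∀ z ∈ unitTriangle u k, (hexForm z : ℝ) = affineFun c z) ∧
      ∀ z ∉ unitTriangle u k, affineFun c z + 1 ≤ (hexForm z : ℝ) := by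
  obtain ⟨c, c0, c1, c2⟩ := exists_affineFun u k (hexForm u : ℝ) (hexForm (u + dir k))
    (hexForm (u + dir (k + 1)))
  refine ⟨c, forall_mem_unitTriangle.2 ⟨c0.symm, c1.symm, c2.symm⟩, fun z hz => ?_⟩
  obtain ⟨x, y, rfl⟩ := exists_frame u z k
  have hQ : 1 ≤ hexForm (x, y) - x - y := by
    have h1 := mul_sub_one_nonneg x
    have h2 := mul_sub_one_nonneg y
    have h3 := mul_sub_one_nonneg (x + y)
    have h4 : x * (x - 1) + y * (y - 1) + (x + y) * (x + y - 1) =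
        2 * (hexForm (x, y) - x - y) := by
      simp only [hexForm]; ring
    by_contra! hc
    have z1 : x * (x - 1) = 0 := by omega
    have z2 : y * (y - 1) = 0 := by omega
    have z3 : (x + y) * (x + y - 1) = 0 := by omega
    rw [mul_eq_zero] at z1 z2 z3
    apply hz
    rw [mem_unitTriangle]
    have : (x = 0 ∧ y = 0) ∨ (x = 1 ∧ y = 0) ∨ (x = 0 ∧ y = 1) := by omega
    rcases this with ⟨rfl, rfl⟩ | ⟨rfl, rfl⟩ | ⟨rfl, rfl⟩ <;> simp
  have hf := hexForm_frame k x y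
  have f1 := hexForm_frame k 1 0
  have f2 := hexForm_frame k 0 1
  simp only [one_smul, zero_smul, add_zero, zero_add] at f1 f2
  simp only [hexForm, affineFun, Prod.fst_add, Prod.snd_add, Prod.smul_fst, Prod.smul_snd,
    smul_eq_mul] at *
  have hf' : ((x : ℝ) * (dir k).1 + y * (dir (k + 1)).1) ^ 2 +
      (x * (dir k).1 + y * (dir (k + 1)).1) * (x * (dir k).2 + y * (dir (k + 1)).2) +
      (x * (dir k).2 + y * (dir (k + 1)).2) ^ 2 = x ^ 2 + x * y + y ^ 2 := by
    exact_mod_cast hf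
  have f1' : ((dir k).1 : ℝ) ^ 2 + (dir k).1 * (dir k).2 + (dir k).2 ^ 2 = 1 := by
    exact_mod_cast f1
  have f2' : ((dir (k + 1)).1 : ℝ) ^ 2 + (dir (k + 1)).1 * (dir (k + 1)).2 +
      (dir (k + 1)).2 ^ 2 = 1 := by
    exact_mod_cast f2
  have hQ' : (1 : ℝ) ≤ x ^ 2 + x * y + y ^ 2 - x - y := by exact_mod_cast hQ
  push_cast at c0 c1 c2 ⊢
  linear_combination hQ' - hf' + (1 - x - y) * c0 + x * c1 + y * c2 + x * f1' + y * f2'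

/-- Small perturbations of the invariant quadratic form induce the honeycomb triangulation. -/
lemma exists_perturbation (hfin : A.Finite) (hA : CoversHull A) (δ : ℤ × ℤ → ℝ) :
    ∃ ε : ℝ, 0 < ε ∧
      regularSubdivision A ((fun z => (hexForm z : ℝ)) + ε • δ) = unitTriangulation A := by
  choose c hc hc' using exists_hexForm_support
  choose e he using fun (u : ℤ × ℤ) (k : Fin 6) =>
    exists_affineFun u k (δ u) (δ (u + dir k)) (δ (u + dir (k + 1)))
  -- Finitely many pairs of a triangle and a point of A are involved, so one ε keeps the gap 1
  -- positive for all of them.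
  have hev : ∀ᶠ ε : ℝ in nhdsWithin 0 (Set.Ioi 0), ∀ q ∈ A ×ˢ (Set.univ : Set (Fin 6)) ×ˢ A,
      0 < 1 + ε * (δ q.2.2 - affineFun (e q.1 q.2.1) q.2.2) := by
    rw [Filter.eventually_all_finite (hfin.prod (Set.finite_univ.prod hfin))]
    intro q _
    have hcont : Continuous fun ε : ℝ => 1 + ε * (δ q.2.2 - affineFun (e q.1 q.2.1) q.2.2) := by
      fun_prop
    have h0 : ∀ᶠ x : ℝ in nhds (1 + 0 * (δ q.2.2 - affineFun (e q.1 q.2.1) q.2.2)), 0 < x :=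
      lt_mem_nhds (by simp)
    exact ((hcont.tendsto 0).eventually h0).filter_mono nhdsWithin_le_nhds
  obtain ⟨ε, hε, hpos⟩ := (hev.and self_mem_nhdsWithin).exists
  refine ⟨ε, hpos, regularSubdivision_eq hA ?_⟩
  rintro _ ⟨u, k, rfl, hT⟩
  have hu := hT u (by simp [unitTriangle])
  have hval : ∀ z, (c u k + ε • e u k).2.1 * z.1 + (c u k + ε • e u k).2.2 * z.2 +
      (c u k + ε • e u k).1 = affineFun (c u k) z + ε * affineFun (e u k) z := by
    intro z
    simp only [affineFun, Prod.fst_add, Prod.snd_add, Prod.smul_fst, Prod.smul_snd, smul_eq_mul]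
    ring
  have hin : ∀ z ∈ unitTriangle u k, affineFun (c u k) z + ε * affineFun (e u k) z =
      hexForm z + ε * δ z := by
    intro z hz
    rw [hc u k z hz]
    obtain ⟨e0, e1, e2⟩ := he u k
    rcases mem_unitTriangle.1 hz with rfl | rfl | rfl
    · rw [e0]
    · rw [e1]
    · rw [e2]
  have hout : ∀ z ∈ A, z ∉ unitTriangle u k →
      affineFun (c u k) z + ε * affineFun (e u k) z < hexForm z + ε * δ z := by
    intro z hz hzT
    have h1 := hc' u k z hzT
    have h2 := hε (u, k, z) ⟨hu, trivial, hz⟩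
    dsimp only at h2
    linarith
  refine ⟨(c u k + ε • e u k).2.1, (c u k + ε • e u k).2.2, (c u k + ε • e u k).1,
    fun z hz => ?_, fun z => ?_, not_collinear_unitTriangle u k⟩
  · rw [hval z]
    by_cases hzT : z ∈ unitTriangle u k
    · exact (hin z hzT).le
    · exact (hout z hz hzT).le
  · rw [hval z]
    exact ⟨fun h => ⟨hT z h, hin z h⟩, fun ⟨h1, h2⟩ => by
      by_contra h3
      exact (hout z h1 h3).ne h2⟩

/-! ### The dimension of the moduli cone -/

lemma IsInner.mem_realizedMetrics_iff (hA : IsInner A I)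
    [Finite (coreGraph (dualGraph (unitTriangulation A))).edgeSet]
    {m : SkeletonEdge (dualGraph (unitTriangulation A)) → ℝ} :
    m ∈ realizedMetrics A (unitTriangulation A) ↔
      ∃ h, regularSubdivision A h = unitTriangulation A ∧ m = skeletonMap A h := by
  have key : ∀ h, regularSubdivision A h = unitTriangulation A →
      ∀ e : (coreGraph (dualGraph (unitTriangulation A))).edgeSet,
        HasLatticeLength (tropicalDual A h (commonFace e)) (bend h e) := by
    rintro h hh ⟨e, he⟩
    obtain ⟨u, hu, k, rfl⟩ := hA.exists_dualEdge he
    exact hasLatticeLength_dualEdge hh (hA.mem_triangulation hu _) (hA.mem_triangulation hu _)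
  constructor
  · rintro ⟨h, hh, l, hl, hm⟩
    refine ⟨h, hh, funext fun q => ?_⟩
    have : l = fun e : (coreGraph (dualGraph (unitTriangulation A))).edgeSet => bend h e :=
      funext fun e => latticeLength_unique (hl e) (key h hh e)
    rw [hm, skeletonMap_apply, this]
  · rintro ⟨h, hh, rfl⟩
    exact ⟨h, hh, fun e => bend h e, key h hh, fun q => skeletonMap_apply h q⟩

lemma IsInner.convexDim_moduliCone (hA : IsInner A I) (hcov : CoversHull A)
    [Finite (coreGraph (dualGraph (unitTriangulation A))).edgeSet] :
    convexDim (moduliCone A (unitTriangulation A)) =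
      Module.finrank ℝ (LinearMap.range (skeletonMap A)) := by
  have : Finite (SkeletonEdge (dualGraph (unitTriangulation A))) :=
    inferInstanceAs (Finite (Quot _))
  suffices vectorSpan ℝ (moduliCone A (unitTriangulation A)) =
      LinearMap.range (skeletonMap A) by rw [convexDim, this]
  apply le_antisymm
  · have h1 : moduliCone A (unitTriangulation A) ⊆ LinearMap.range (skeletonMap A) := by
      refine closure_minimal ?_ (Submodule.closed_of_finiteDimensional _)
      intro m hm
      obtain ⟨h, -, rfl⟩ := hA.mem_realizedMetrics_iff.1 hm
      exact ⟨h, rfl⟩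
    rw [vectorSpan, Submodule.span_le]
    rintro _ ⟨x, hx, y, hy, rfl⟩
    exact Submodule.sub_mem _ (h1 hx) (h1 hy)
  · rintro _ ⟨δ, rfl⟩
    have key : ∀ h, regularSubdivision A h = unitTriangulation A →
        skeletonMap A h ∈ moduliCone A (unitTriangulation A) := fun h hh =>
      subset_closure (hA.mem_realizedMetrics_iff.2 ⟨h, hh, rfl⟩)
    -- The metrics of q + εδ and q differ by ε times the image of δ.
    obtain ⟨ε, hε, h1⟩ := exists_perturbation hA.finite hcov δ
    obtain ⟨_, -, h0⟩ := exists_perturbation hA.finite hcov 0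
    rw [smul_zero, add_zero] at h0
    have := vsub_mem_vectorSpan ℝ (key _ h1) (key _ h0)
    rw [vsub_eq_sub, ← map_sub, add_sub_cancel_left, map_smul] at this
    have h2 := Submodule.smul_mem _ ε⁻¹ this
    rwa [smul_smul, inv_mul_cancel₀ hε.ne', one_smul] at h2

/-! ### The convex hull of a hexagonal set -/

lemma toPlane_injective : Function.Injective toPlane := by
  intro u v h
  simp only [toPlane, Prod.mk.injEq, Int.cast_inj] at h
  exact Prod.ext h.1 h.2

/-- The linear functional with value `1` at `dir k` and `dir (k + 1)`. -/
def normal : Fin 6 → ℤ × ℤ := ![(1, 1), (0, 1), (-1, 0), (-1, -1), (0, -1), (1, 0)]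

/-- The value of a functional at a point. -/
def pair (n : ℤ × ℤ) (p : ℝ × ℝ) : ℝ := n.1 * p.1 + n.2 * p.2

lemma pair_toPlane (n u : ℤ × ℤ) : pair n (toPlane u) = (n.1 * u.1 + n.2 * u.2 : ℤ) := by
  simp [pair, toPlane]

lemma pair_combo (n : ℤ × ℤ) (α β : ℝ) (p q : ℝ × ℝ) :
    pair n (α • p + β • q) = α * pair n p + β * pair n q := by
  simp only [pair, Prod.fst_add, Prod.snd_add, Prod.smul_fst, Prod.smul_snd, smul_eq_mul]
  ring

/-- The functional `n` attains its maximum on `I` at `u`. -/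
def Supports (I : Set (ℤ × ℤ)) (n u : ℤ × ℤ) : Prop :=
  ∀ z ∈ I, n.1 * z.1 + n.2 * z.2 ≤ n.1 * u.1 + n.2 * u.2

lemma pair_le_of_mem_convexHull {n : ℤ × ℤ} {m : ℝ}
    (h : ∀ z ∈ I, pair n (toPlane z) ≤ m) {p : ℝ × ℝ}
    (hp : p ∈ convexHull ℝ (toPlane '' I)) : pair n p ≤ m := by
  refine convexHull_min (t := {p | pair n p ≤ m}) ?_ ?_ hp
  · rintro _ ⟨z, hz, rfl⟩
    exact h z hz
  · intro p hp q hq α β hα hβ hαβ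
    rw [Set.mem_ofPred_eq, pair_combo]
    have h1 := mul_le_mul_of_nonneg_left hp hα
    have h2 := mul_le_mul_of_nonneg_left hq hβ
    linear_combination h1 + h2 + m * hαβ

lemma Supports.pair_le {n u : ℤ × ℤ} (h : Supports I n u) {p : ℝ × ℝ}
    (hp : p ∈ convexHull ℝ (toPlane '' I)) : pair n p ≤ pair n (toPlane u) :=
  pair_le_of_mem_convexHull (fun z hz => by
    rw [pair_toPlane, pair_toPlane]; exact_mod_cast h z hz) hp

/-- The step along dir k violates a bound of I, which is therefore attained at u. Among the six
bounding functionals only `normal k` and `normal (k - 1)` increase along dir k. -/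
lemma IsHexagonal.supports (hI : IsHexagonal I) {u : ℤ × ℤ} {k : Fin 6} (hu : u ∈ I)
    (hk : u + dir k ∉ I) : Supports I (normal k) u ∨ Supports I (normal (k - 1)) u := by
  obtain ⟨α, β, γ, δ, σ, τ, h⟩ := hI
  by_contra! hc
  obtain ⟨h1, h2⟩ := hc
  unfold Supports at h1 h2
  push Not at h1 h2
  obtain ⟨⟨x, y⟩, hz, h1⟩ := h1
  obtain ⟨⟨x', y'⟩, hz', h2⟩ := h2
  obtain ⟨u, v⟩ := u
  rw [h] at hu hz hz'
  apply hk
  fin_cases k <;> simp [normal, dir, h, show (2 - 1 : Fin 6) = 1 from rfl,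
    show (3 - 1 : Fin 6) = 2 from rfl, show (4 - 1 : Fin 6) = 3 from rfl,
    show (5 - 1 : Fin 6) = 4 from rfl, show (-1 : Fin 6) = 5 from rfl] at h1 h2 ⊢ <;> omega

lemma IsHexagonal.latticePoints_convexHull (hI : IsHexagonal I) :
    latticePoints (convexHull ℝ (toPlane '' I)) = I := by
  obtain ⟨α, β, γ, δ, σ, τ, h⟩ := hI
  apply Set.Subset.antisymm
  · rintro ⟨x, y⟩ hz
    have key : ∀ (n : ℤ × ℤ) (m : ℤ), (∀ z ∈ I, n.1 * z.1 + n.2 * z.2 ≤ m) →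
        n.1 * x + n.2 * y ≤ m := by
      intro n m hm
      have := pair_le_of_mem_convexHull (n := n) (m := m) (fun z hz => by
        rw [pair_toPlane]; exact_mod_cast hm z hz) hz
      rw [pair_toPlane] at this
      exact_mod_cast this
    have h1 := key (1, 0) β fun z hz => by have := (h z.1 z.2).1 hz; dsimp only; omega
    have h2 := key (-1, 0) (-α) fun z hz => by have := (h z.1 z.2).1 hz; dsimp only; omega
    have h3 := key (0, 1) δ fun z hz => by have := (h z.1 z.2).1 hz; dsimp only; omega
    have h4 := key (0, -1) (-γ) fun z hz => by have := (h z.1 z.2).1 hz; dsimp only; omega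
    have h5 := key (1, 1) τ fun z hz => by have := (h z.1 z.2).1 hz; dsimp only; omega
    have h6 := key (-1, -1) (-σ) fun z hz => by have := (h z.1 z.2).1 hz; dsimp only; omega
    rw [h]
    dsimp only at *
    omega
  · intro z hz
    exact subset_convexHull ℝ _ ⟨z, hz, rfl⟩

lemma pair_normal_dir (k : Fin 6) :
    (normal k).1 * (dir k).1 + (normal k).2 * (dir k).2 = 1 ∧
      (normal (k - 1)).1 * (dir k).1 + (normal (k - 1)).2 * (dir k).2 = 1 := by
  revert k; decide

lemma Supports.notMem_interior {n u d : ℤ × ℤ} (h : Supports I n u)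
    (hd : n.1 * d.1 + n.2 * d.2 = 1) :
    toPlane u ∉ interior (convexHull ℝ (toPlane '' I)) := by
  intro hu
  have hcont : Continuous fun t : ℝ => toPlane u + t • toPlane d := by fun_prop
  have h1 : ∀ᶠ t : ℝ in nhdsWithin 0 (Set.Ioi 0),
      toPlane u + t • toPlane d ∈ interior (convexHull ℝ (toPlane '' I)) := by
    refine Filter.Eventually.filter_mono nhdsWithin_le_nhds ?_
    exact (hcont.tendsto 0).eventually (isOpen_interior.mem_nhds (by simpa using hu))
  obtain ⟨t, ht, ht0⟩ := (h1.and self_mem_nhdsWithin).exists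
  have h2 := h.pair_le (interior_subset ht)
  have h3 := pair_combo n 1 t (toPlane u) (toPlane d)
  rw [one_smul] at h3
  rw [h3, pair_toPlane n d, hd] at h2
  push_cast at h2
  linarith

/-- The four neighbours along the coordinate axes already span the open ℓ¹ unit ball around u. -/
lemma mem_interior_of_neighbors {u : ℤ × ℤ} (hu : u ∈ I) (h : ∀ k, u + dir k ∈ I) :
    toPlane u ∈ interior (convexHull ℝ (toPlane '' I)) := by
  rw [mem_interior]
  refine ⟨{p | |p.1 - u.1| + |p.2 - u.2| < 1}, ?_, isOpen_lt (by fun_prop) (by fun_prop), ?_⟩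
  · rintro ⟨x, y⟩ hp
    rw [Set.mem_ofPred_eq] at hp
    dsimp only at hp
    have hsub := subset_convexHull ℝ (toPlane '' I)
    have h0 := hsub ⟨u, hu, rfl⟩
    have key : ∀ k l : Fin 6, ∀ α β : ℝ, 0 ≤ α → 0 ≤ β → α + β ≤ 1 →
        x = u.1 + α * (dir k).1 + β * (dir l).1 → y = u.2 + α * (dir k).2 + β * (dir l).2 →
        (x, y) ∈ convexHull ℝ (toPlane '' I) := by
      intro k l α β hα hβ hαβ hx hy
      have := convex_combo_three (convex_convexHull ℝ (toPlane '' I)) h0 (hsub ⟨_, h k, rfl⟩)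
        (hsub ⟨_, h l, rfl⟩) (sub_nonneg.2 hαβ) hα hβ (by ring)
      convert this using 1
      ext
      · simp only [toPlane, Prod.fst_add, Prod.smul_fst, smul_eq_mul, hx]
        push_cast
        ring
      · simp only [toPlane, Prod.snd_add, Prod.smul_snd, smul_eq_mul, hy]
        push_cast
        ring
    rcases abs_cases (x - u.1) with ⟨hx, hx'⟩ | ⟨hx, hx'⟩ <;>
      rcases abs_cases (y - u.2) with ⟨hy, hy'⟩ | ⟨hy, hy'⟩ <;> rw [hx, hy] at hp
    · exact key 0 1 (x - u.1) (y - u.2) (by linarith) (by linarith) (by linarith)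
        (by simp [dir]) (by simp [dir])
    · exact key 0 4 (x - u.1) (-(y - u.2)) (by linarith) (by linarith) (by linarith)
        (by simp [dir]) (by simp [dir])
    · exact key 3 1 (-(x - u.1)) (y - u.2) (by linarith) (by linarith) (by linarith)
        (by simp [dir]) (by simp [dir])
    · exact key 3 4 (-(x - u.1)) (-(y - u.2)) (by linarith) (by linarith) (by linarith)
        (by simp [dir]) (by simp [dir])
  · simp [toPlane]

lemma IsHexagonal.latticePoints_frontier (hI : IsHexagonal I) (hfin : I.Finite) :
    latticePoints (frontier (convexHull ℝ (toPlane '' I))) = boundaryPoints I := by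
  have hcl : IsClosed (convexHull ℝ (toPlane '' I)) := (hfin.image toPlane).isClosed_convexHull ℝ
  ext u
  have hmem : toPlane u ∈ convexHull ℝ (toPlane '' I) ↔ u ∈ I := by
    nth_rw 2 [← hI.latticePoints_convexHull]
    rfl
  change toPlane u ∈ frontier _ ↔ _
  rw [hcl.frontier_eq, Set.mem_sdiff, hmem]
  refine and_congr_right fun hu => ?_
  constructor
  · intro h
    by_contra! hc
    exact h (mem_interior_of_neighbors hu hc)
  · rintro ⟨k, hk⟩
    rcases hI.supports hu hk with h | h
    · exact h.notMem_interior (pair_normal_dir k).1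
    · exact h.notMem_interior (pair_normal_dir k).2

/-- Used for the neighbours of a point of I that is not a corner: such a point is the midpoint of
two others and hence not extreme. -/
lemma exists_opposite (p : Fin 6 → Bool) (h1 : ∀ k, p (k - 1) ∨ p k ∨ p (k + 1))
    (h2 : ∀ k, p k → p (k + 2) → p (k + 1)) : ∃ j, p j ∧ p (j + 3) := by
  revert p; decide

lemma normal_det (k : Fin 6) :
    (normal k).1 * (normal (k + 1)).2 - (normal k).2 * (normal (k + 1)).1 = 1 ∧
      (normal k).1 * (normal (k + 2)).2 - (normal k).2 * (normal (k + 2)).1 = 1 := by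
  revert k; decide

lemma mem_extremePoints_of_supports {n n' u : ℤ × ℤ} (hu : u ∈ I) (h : Supports I n u)
    (h' : Supports I n' u) (hdet : n.1 * n'.2 - n.2 * n'.1 = 1) :
    toPlane u ∈ (convexHull ℝ (toPlane '' I)).extremePoints ℝ := by
  have hdet' : (n.1 : ℝ) * n'.2 - n.2 * n'.1 = 1 := by exact_mod_cast hdet
  refine mem_extremePoints_iff_left.2 ⟨subset_convexHull ℝ _ ⟨u, hu, rfl⟩, ?_⟩
  rintro x hx y hy ⟨α, β, hα, hβ, hαβ, hxy⟩
  have key : ∀ {n}, Supports I n u → pair n x = pair n (toPlane u) := by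
    intro n h
    refine le_antisymm (h.pair_le hx) ?_
    have h1 := mul_le_mul_of_nonneg_left (h.pair_le hy) hβ.le
    have h2 := pair_combo n α β x y
    rw [hxy] at h2
    refine le_of_mul_le_mul_left ?_ hα
    linear_combination h1 + h2 + pair n (toPlane u) * hαβ
  have e := key h
  have e' := key h'
  simp only [pair] at e e'
  ext
  · linear_combination (-(x.1 - (toPlane u).1)) * hdet' + (n'.2 : ℝ) * e - (n.2 : ℝ) * e'
  · linear_combination (-(x.2 - (toPlane u).2)) * hdet' + (n.1 : ℝ) * e' - (n'.1 : ℝ) * e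

lemma IsHexagonal.extremePoints_convexHull (hI : IsHexagonal I) :
    (convexHull ℝ (toPlane '' I)).extremePoints ℝ = toPlane '' cornerPoints I := by
  classical
  apply Set.Subset.antisymm
  · intro p hp
    obtain ⟨u, hu, rfl⟩ := extremePoints_convexHull_subset hp
    refine ⟨u, ⟨hu, ?_⟩, rfl⟩
    by_contra hc
    obtain ⟨j, h1, h2⟩ := exists_opposite (fun k => decide (u + dir k ∈ I))
      (fun k => by
        by_contra! h
        simp only [ne_eq, decide_eq_true_eq] at h
        exact hc ⟨k, h⟩)
      (fun k h1 h2 => by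
        simp only [decide_eq_true_eq] at *
        exact (hI.short_diagonal h1 h2).2)
    simp only [decide_eq_true_eq] at h1 h2
    have hsub := subset_convexHull ℝ (toPlane '' I)
    have := (mem_extremePoints_iff_left.1 hp).2 _ (hsub ⟨_, h1, rfl⟩) _ (hsub ⟨_, h2, rfl⟩)
      ⟨1 / 2, 1 / 2, by norm_num, by norm_num, by norm_num, by
        rw [dir_add_three]
        ext
        · simp [toPlane]; ring
        · simp [toPlane]; ring⟩
    exact add_dir_ne u j (toPlane_injective this)
  · rintro _ ⟨u, ⟨hu, k, k1, k2, k3⟩, rfl⟩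
    have e1 : k - 1 - 1 = k - 2 := by rw [sub_sub]; rfl
    have e2 : k + 1 - 1 = k := add_sub_cancel_right k 1
    have d1 := (normal_det (k - 1)).1
    have d2 := (normal_det (k - 1)).2
    have d3 := (normal_det (k - 2)).2
    rw [sub_add_cancel] at d1 d3
    rw [show k - 1 + 2 = k + 1 by clear * -; revert k; decide] at d2
    -- Each missing neighbour makes one of two consecutive functionals maximal at u. In every case
    -- two of the three missing neighbours supply functionals of determinant 1, and these single out
    -- u.
    rcases hI.supports hu k2 with h | h
    · rcases hI.supports hu k1 with h' | h'
      · exact mem_extremePoints_of_supports hu h' h d1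
      · rw [e1] at h'
        exact mem_extremePoints_of_supports hu h' h d3
    · rcases hI.supports hu k3 with h' | h'
      · exact mem_extremePoints_of_supports hu h h' d2
      · rw [e2] at h'
        exact mem_extremePoints_of_supports hu h h' d1

/-! ### The honeycomb polygon -/

variable {a b c d : ℤ}

lemma mem_latticePoints_honeycombPolygon {z : ℤ × ℤ} :
    z ∈ latticePoints (honeycombPolygon a b c d) ↔
      0 ≤ z.1 ∧ z.1 ≤ a ∧ 0 ≤ z.2 ∧ z.2 ≤ b ∧ c ≤ z.1 + z.2 ∧ z.1 + z.2 ≤ d := by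
  simp only [latticePoints, honeycombPolygon, toPlane, Set.mem_ofPred_eq]
  norm_cast

lemma interior_honeycombPolygon : interior (honeycombPolygon a b c d) =
    {p : ℝ × ℝ | 0 < p.1 ∧ p.1 < a ∧ 0 < p.2 ∧ p.2 < b ∧ c < p.1 + p.2 ∧ p.1 + p.2 < d} := by
  have hadd : IsOpenMap fun p : ℝ × ℝ => p.1 + p.2 :=
    (ContinuousLinearMap.fst ℝ ℝ ℝ + ContinuousLinearMap.snd ℝ ℝ ℝ).isOpenMap
      fun t => ⟨(t, 0), by simp⟩
  have key : ∀ {f : ℝ × ℝ → ℝ}, IsOpenMap f → Continuous f → ∀ s : Set ℝ,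
      interior (f ⁻¹' s) = f ⁻¹' interior s := fun hf hf' s =>
    (hf.preimage_interior_eq_interior_preimage hf' s).symm
  have h1 : honeycombPolygon a b c d =
      (Prod.fst ⁻¹' Set.Icc (0 : ℝ) a) ∩ (Prod.snd ⁻¹' Set.Icc (0 : ℝ) b) ∩
        ((fun p : ℝ × ℝ => p.1 + p.2) ⁻¹' Set.Icc (c : ℝ) d) := by
    ext p
    simp only [honeycombPolygon, Set.mem_ofPred_eq, Set.mem_inter_iff, Set.mem_preimage,
      Set.mem_Icc]
    tauto
  rw [h1, interior_inter, interior_inter, key isOpenMap_fst continuous_fst,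
    key isOpenMap_snd continuous_snd, key hadd (by fun_prop), interior_Icc, interior_Icc,
    interior_Icc]
  ext p
  simp only [Set.mem_ofPred_eq, Set.mem_inter_iff, Set.mem_preimage, Set.mem_Ioo]
  tauto

lemma mem_latticePoints_interior {z : ℤ × ℤ} :
    z ∈ latticePoints (interior (honeycombPolygon a b c d)) ↔
      0 < z.1 ∧ z.1 < a ∧ 0 < z.2 ∧ z.2 < b ∧ c < z.1 + z.2 ∧ z.1 + z.2 < d := by
  rw [interior_honeycombPolygon]
  simp only [latticePoints, toPlane, Set.mem_ofPred_eq]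
  norm_cast

lemma honeycombTriangulation_eq : honeycombTriangulation a b c d =
    unitTriangulation (latticePoints (honeycombPolygon a b c d)) := by
  ext T
  constructor
  · rintro ⟨⟨i, j, rfl | rfl⟩, h⟩
    · refine ⟨(i, j), 0, ?_, h⟩
      ext ⟨x, y⟩
      simp [unitTriangle, dir]
    · refine ⟨(i + 1, j + 1), 3, ?_, h⟩
      ext ⟨x, y⟩
      simp [unitTriangle, dir]
      omega
  · rintro ⟨⟨i, j⟩, k, rfl, h⟩
    refine ⟨?_, h⟩
    fin_cases k
    · exact ⟨i, j, Or.inl (by ext ⟨x, y⟩; simp [unitTriangle, dir])⟩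
    · exact ⟨i - 1, j, Or.inr (by ext ⟨x, y⟩; simp [unitTriangle, dir]; omega)⟩
    · exact ⟨i - 1, j, Or.inl (by ext ⟨x, y⟩; simp [unitTriangle, dir]; omega)⟩
    · exact ⟨i - 1, j - 1, Or.inr (by ext ⟨x, y⟩; simp [unitTriangle, dir]; omega)⟩
    · exact ⟨i, j - 1, Or.inl (by ext ⟨x, y⟩; simp [unitTriangle, dir]; omega)⟩
    · exact ⟨i, j - 1, Or.inr (by
        ext ⟨x, y⟩; simp [unitTriangle, dir, show (5 + 1 : Fin 6) = 0 from rfl]; omega)⟩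

lemma isInner_honeycombPolygon
    (hne : (latticePoints (interior (honeycombPolygon a b c d))).Nonempty) :
    IsInner (latticePoints (honeycombPolygon a b c d))
      (latticePoints (interior (honeycombPolygon a b c d))) where
  finite := by
    refine ((Set.finite_Icc 0 a).prod (Set.finite_Icc 0 b)).subset fun z hz => ?_
    rw [mem_latticePoints_honeycombPolygon] at hz
    exact ⟨⟨hz.1, hz.2.1⟩, hz.2.2.1, hz.2.2.2.1⟩
  hex := by
    refine ⟨1, a - 1, 1, b - 1, c + 1, d - 1, fun x y => ?_⟩
    rw [mem_latticePoints_interior]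
    dsimp only
    omega
  subset z hz := interior_subset (s := honeycombPolygon a b c d) hz
  neighbor := by
    rintro ⟨x, y⟩ hu k
    rw [mem_latticePoints_interior] at hu
    rw [mem_latticePoints_honeycombPolygon]
    fin_cases k <;> simp [dir] at hu ⊢ <;> omega
  corner := by
    rintro ⟨x, y⟩ k h0 h1 h2 h3 h4
    -- An interior point makes a, b and d - c at least 2; in a strip of width one the assertion
    -- fails.
    obtain ⟨⟨x', y'⟩, hz⟩ := hne
    rw [mem_latticePoints_interior] at hz
    simp only [mem_latticePoints_honeycombPolygon] at h0 h1 h2 h3 h4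
    simp only [mem_latticePoints_interior]
    fin_cases k <;> simp [dir, show (2 - 1 : Fin 6) = 1 from rfl,
      show (3 - 1 : Fin 6) = 2 from rfl, show (4 - 1 : Fin 6) = 3 from rfl,
      show (5 - 1 : Fin 6) = 4 from rfl, show (-1 : Fin 6) = 5 from rfl,
      show (2 + 1 : Fin 6) = 3 from rfl, show (3 + 1 : Fin 6) = 4 from rfl,
      show (4 + 1 : Fin 6) = 5 from rfl, show (5 + 1 : Fin 6) = 0 from rfl,
      show (1 + 2 : Fin 6) = 3 from rfl, show (2 + 2 : Fin 6) = 4 from rfl,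
      show (3 + 2 : Fin 6) = 5 from rfl, show (4 + 2 : Fin 6) = 0 from rfl,
      show (5 + 2 : Fin 6) = 1 from rfl] at h0 h1 h2 h3 h4 hz ⊢ <;> omega

lemma coversHull_honeycombPolygon : CoversHull (latticePoints (honeycombPolygon a b c d)) := by
  intro p hp hgen
  obtain ⟨x, y⟩ := p
  have hP : (x, y) ∈ honeycombPolygon a b c d := by
    refine convexHull_min ?_ ?_ hp
    · rintro _ ⟨z, hz, rfl⟩
      exact hz
    · rintro p ⟨h1, h2, h3, h4, h5, h6⟩ q ⟨g1, g2, g3, g4, g5, g6⟩ α β hα hβ hαβ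
      refine ⟨?_, ?_, ?_, ?_, ?_, ?_⟩ <;>
        simp only [Prod.fst_add, Prod.snd_add, Prod.smul_fst, Prod.smul_snd, smul_eq_mul]
      · positivity
      · linear_combination α * h2 + β * g2 + a * hαβ
      · positivity
      · linear_combination α * h4 + β * g4 + b * hαβ
      · linear_combination α * h5 + β * g5 - c * hαβ
      · linear_combination α * h6 + β * g6 + d * hαβ
  obtain ⟨h1, h2, h3, h4, h5, h6⟩ := hP
  dsimp only at *
  have low : ∀ (t : ℝ) (m : ℤ), (m : ℝ) ≤ t → m ≤ ⌊t⌋ := fun t m => Int.le_floor.2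
  -- General position makes the upper bounds strict, so that the upper corner of the unit cell still
  -- satisfies them.
  have up : ∀ (t : ℝ) (m : ℤ), t ≤ m → t ≠ m → ⌊t⌋ + 1 ≤ m := fun t m h h' =>
    Int.add_one_le_iff.2 (Int.floor_lt.2 (lt_of_le_of_ne h h'))
  have i1 := low x 0 (by exact_mod_cast h1)
  have i2 := up x a h2 (hgen a).1
  have j1 := low y 0 (by exact_mod_cast h3)
  have j2 := up y b h4 (hgen b).2.1
  have s1 := low (x + y) c h5
  have s2 := up (x + y) d h6 (hgen d).2.2
  have fx := Int.fract_nonneg x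
  have fx' := (Int.fract_lt_one x).le
  have fy := Int.fract_nonneg y
  have fy' := (Int.fract_lt_one y).le
  have ex := Int.floor_add_fract x
  have ey := Int.floor_add_fract y
  set i := ⌊x⌋
  set j := ⌊y⌋
  set f := Int.fract x
  set g := Int.fract y
  -- The sum of the fractional parts decides in which half of the unit square the point lies; these
  -- parts also provide the barycentric coordinates.
  rcases le_or_gt 1 (f + g) with hfg | hfg
  · have hs : ⌊x + y⌋ = i + j + 1 := by
      rw [Int.floor_eq_iff]
      push_cast
      refine ⟨by linarith, ?_⟩
      have := Int.fract_lt_one x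
      have := Int.fract_lt_one y
      linarith
    refine ⟨(i + 1, j + 1), 3, ?_, f + g - 1, 1 - f, 1 - g, by linarith, by linarith,
      by linarith, by ring, ?_⟩
    · simp only [unitTriangle_mem, mem_latticePoints_honeycombPolygon]
      simp [dir, show (3 + 1 : Fin 6) = 4 from rfl]
      omega
    · ext
      · simp [toPlane, dir, show (3 + 1 : Fin 6) = 4 from rfl]
        linear_combination -ex
      · simp [toPlane, dir, show (3 + 1 : Fin 6) = 4 from rfl]
        linear_combination -ey
  · have hs : ⌊x + y⌋ = i + j := by
      rw [Int.floor_eq_iff]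
      push_cast
      exact ⟨by linarith, by linarith⟩
    refine ⟨(i, j), 0, ?_, 1 - f - g, f, g, by linarith, fx, fy, by ring, ?_⟩
    · simp only [unitTriangle_mem, mem_latticePoints_honeycombPolygon]
      simp [dir]
      omega
    · ext
      · simp [toPlane, dir]
        linear_combination -ex
      · simp [toPlane, dir]
        linear_combination -ey

end TropHoneycomb

theorem lemma4p2 (a b c d : ℤ)
    (hc : 0 ≤ c) (hca : c ≤ a) (hcb : c ≤ b) (had : a ≤ d) (hbd : b ≤ d) (hdab : d ≤ a + b)
    (hg : 2 ≤ (TropHoneycomb.latticePoints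
      (interior (TropHoneycomb.honeycombPolygon a b c d))).ncard) :
    (TropHoneycomb.convexDim
        (TropHoneycomb.moduliCone
          (TropHoneycomb.latticePoints (TropHoneycomb.honeycombPolygon a b c d))
          (TropHoneycomb.honeycombTriangulation a b c d)) : ℤ) =
      ((TropHoneycomb.latticePoints
          (TropHoneycomb.interiorHull (TropHoneycomb.honeycombPolygon a b c d))).ncard : ℤ)
      + ((TropHoneycomb.latticePoints
          (frontier (TropHoneycomb.interiorHull
            (TropHoneycomb.honeycombPolygon a b c d)))).ncard : ℤ)
      + (((TropHoneycomb.interiorHull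
          (TropHoneycomb.honeycombPolygon a b c d)).extremePoints ℝ).ncard : ℤ)
      - 3 := by
  have hA := TropHoneycomb.isInner_honeycombPolygon (a := a) (b := b) (c := c) (d := d)
    (Set.nonempty_of_ncard_ne_zero (by omega))
  have := hA.finite_edgeSet
  have hrank := hA.finrank_range_add_three hg
  rw [TropHoneycomb.honeycombTriangulation_eq,
    hA.convexDim_moduliCone TropHoneycomb.coversHull_honeycombPolygon,
    TropHoneycomb.interiorHull, hA.hex.latticePoints_convexHull,
    hA.hex.latticePoints_frontier (hA.finite.subset hA.subset), hA.hex.extremePoints_convexHull,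
    Set.ncard_image_of_injective _ TropHoneycomb.toPlane_injective]
  omega
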